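/- Let $\mathcal{O}$ be a complete discrete valuation ring, and let $A$ be a flat $\mathcal{O}$-algebra that is a complete Noetherian local ring and a local complete intersection. Let $R$ be a commutative local $A$-algebra that is free of finite rank $d$ as an $A$-module, let $\mathcal{E}: R \to A$ be a homomorphism of $A$-algebras, put $I=\ker(\mathcal{E})$, and let $r_0 \in \mathrm{Ann}_R(I)$. Assume that $R^0 := R/\mathrm{Ann}_R(I)$ is a free $A$-module of rank $d-1$, that $r_0$ generates $\mathrm{Ann}_R(I)$ as an $A$-module, and that $\mathcal{E}(r_0)$ is not a zero divisor in $A$ (that is, $(\mathcal{O},A,R,\mathcal{E},r_0)$ is a single-Eisenstein Hecke algebra setup). Assume also that $R^0 \neq 0$. Let $I^0 \subset R^0$ be the image of $I$; note that the action of $R$ on $I$ factors through $R^0$. Let $p$ be a prime number and let $(X,\phi,x,\mathcal{L})$ be an $L$-symbol setup: $X$ is an $R$-module, $\phi: X \to A$ is an $A$-linear map with kernel $X^0$, $x \in X$ satisfies $\phi(x)=1$, $\mathcal{L} \in X^0 \otimes_{\mathcal{O}} \mathcal{O}[\![\mathbb{Z}_p^\times]\!]$, and there is an isomorphism of $R$-modules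 $X \cong \mathrm{Hom}_A(R,A)$ that maps $X^0$ onto $\mathrm{Hom}_A(R^0,A) \subset \mathrm{Hom}_A(R,A)$. (Hence $X^0$ is an $R^0$-module.) A local ring is called a local complete intersection ring if it is Noetherian and its completion is the quotient of a regular local ring by an ideal generated by a regular sequence; a Noetherian local ring is called Gorenstein if it has a dualizing (canonical) module that is free of rank $1$, where a dualizing module of a Cohen--Macaulay local ring is a maximal Cohen--Macaulay module of type $1$ and of finite injective dimension. Then the following are equivalent: \begin{enumerate} \item $I^0$ is a principal ideal of $R^0$. \item $I$ is a principal ideal of $R$. \item $I$ is a free $R^0$-module of rank $1$. \item Both $R$ and $R^0$ are local complete intersection rings. \item Both $R$ and $R^0$ are Gorenstein. \item There is $t \in I$ such that $t\cdot x$ lies in $X^0$ and generates $X^0$ as an $R^0$-module. \end{enumerate} Furthermore, if these statements are true, then for $t \in I$ the element $t \cdot x$ generates $X^0$ as an $R^0$-module if and only if $t$ generates the ideal $I$. -/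

import Mathlib

open CategoryTheory IsLocalRing
open scoped TensorProduct

universe u v w

/-! ### Commutative algebra of Noetherian local rings -/

/-- A local ring `B` is a *complete intersection*: it is Noetherian and its completion is the
quotient of a regular local ring by an ideal generated by a regular sequence. -/
def IsLocalCompleteIntersectionRing (B : Type u) [CommRing B] : Prop :=
  ∃ _ : IsLocalRing B, IsNoetherianRing B ∧
    ∃ (S : Type u) (_ : CommRing S) (_ : IsRegularLocalRing S) (rs : List S),
      RingTheory.Sequence.IsRegular S rs ∧
        Nonempty (AdicCompletion (maximalIdeal B) B ≃+* S ⧸ Ideal.ofList rs)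

/-- A module `M` over a Noetherian local ring `B` is *maximal Cohen–Macaulay*: it is finitely
generated and has a regular sequence in the maximal ideal whose length is the Krull dimension
of `B`. -/
def IsMaximalCohenMacaulay (B : Type u) [CommRing B] [IsLocalRing B]
    (M : Type u) [AddCommGroup M] [Module B M] : Prop :=
  Module.Finite B M ∧ ∃ rs : List B, (∀ r ∈ rs, r ∈ maximalIdeal B) ∧
    RingTheory.Sequence.IsRegular M rs ∧ (rs.length : WithBot ℕ∞) = ringKrullDim B

/-- A *dualizing module* (also called *canonical module*) of a Cohen–Macaulay local ring `B` is a
maximal Cohen–Macaulay module `M` of type `1` (that is, `Ext^d(k, M)` is one-dimensional over the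
residue field `k`, where `d = dim B = depth M`) and of finite injective dimension. -/
structure IsDualizingModule (B : Type u) [CommRing B] [IsLocalRing B]
    (M : Type u) [AddCommGroup M] [Module B M] : Prop where
  cohenMacaulay_ring : IsMaximalCohenMacaulay B B
  maximalCohenMacaulay : IsMaximalCohenMacaulay B M
  type_one : ∀ d : ℕ, (d : WithBot ℕ∞) = ringKrullDim B →
    Nonempty (Abelian.Ext (ModuleCat.of B (ResidueField B)) (ModuleCat.of B M) d
      ≃ₗ[B] ResidueField B)
  finite_injectiveDimension :
    ∃ n : ℕ, HasInjectiveDimensionLE (ModuleCat.of B M) n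

/-- A (Noetherian) local ring is *Gorenstein* if it has a dualizing module that is free of
rank `1`. -/
def IsGorensteinLocalRing (B : Type u) [CommRing B] : Prop :=
  ∃ _ : IsLocalRing B, IsNoetherianRing B ∧
    ∃ (M : Type u) (_ : AddCommGroup M) (_ : Module B M),
      IsDualizingModule B M ∧ Module.Free B M ∧ Module.finrank B M = 1

/-! ### Single-Eisenstein Hecke algebra setups -/

/-- A *single-Eisenstein Hecke algebra setup* `(O, A, R, eis, r₀)`. The kernel of `eis` is written
`RingHom.ker eis` and `(RingHom.ker eis).annihilator` is its annihilator in `R`. -/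
structure SingleEisensteinSetup (O : Type v) (A R : Type u)
    [CommRing O] [IsDomain O] [IsDiscreteValuationRing O] [IsAdicComplete (maximalIdeal O) O]
    [CommRing A] [IsLocalRing A] [IsNoetherianRing A] [IsAdicComplete (maximalIdeal A) A]
    [Algebra O A] [Module.Flat O A]
    [CommRing R] [IsLocalRing R] [Algebra A R] where
  /-- `A` is a local complete intersection ring. -/
  completeIntersection : IsLocalCompleteIntersectionRing A
  /-- The Eisenstein homomorphism. -/
  eis : R →ₐ[A] A
  /-- The distinguished element. -/
  r₀ : R
  r₀_mem : r₀ ∈ (RingHom.ker eis).annihilator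
  free : Module.Free A R
  finite : Module.Finite A R
  free_quotient : Module.Free A (R ⧸ (RingHom.ker eis).annihilator)
  finrank_quotient :
    Module.finrank A (R ⧸ (RingHom.ker eis).annihilator) + 1 = Module.finrank A R
  span_r₀ : Submodule.span A {r₀} = ((RingHom.ker eis).annihilator).restrictScalars A
  eis_r₀ : eis r₀ ∈ nonZeroDivisors A

namespace SingleEisensteinSetup

variable {O : Type v} {A R : Type u}
    [CommRing O] [IsDomain O] [IsDiscreteValuationRing O] [IsAdicComplete (maximalIdeal O) O]
    [CommRing A] [IsLocalRing A] [IsNoetherianRing A] [IsAdicComplete (maximalIdeal A) A]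
    [Algebra O A] [Module.Flat O A]
    [CommRing R] [IsLocalRing R] [Algebra A R]
    (S : SingleEisensteinSetup O A R)

/-- The ideal `I = ker eis` of `R`. -/
abbrev I : Ideal R := RingHom.ker S.eis

/-- The ring `R⁰ = R / Ann_R(I)`. -/
abbrev R0 : Type u := R ⧸ S.I.annihilator

/-- The image `I⁰` of `I` in `R⁰`. -/
def I0 : Ideal S.R0 := S.I.map (Ideal.Quotient.mk S.I.annihilator)

/-- The action of `R` on `I` factors through `R⁰`. -/
noncomputable instance moduleI : Module S.R0 S.I := Module.quotientAnnihilator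

end SingleEisensteinSetup

/-! ### `L`-symbol setups -/

/-- The completed group ring `O⟦ℤ_pˣ⟧`, the inverse limit of the group rings `O[(ℤ/pⁿ)ˣ]`, as a
`O`-subalgebra of their product. -/
noncomputable def CompletedGroupRing (p : ℕ) (O : Type v) [CommRing O] :
    Subalgebra O (∀ n : ℕ, MonoidAlgebra O (ZMod (p ^ n))ˣ) where
  carrier := {f | ∀ n, MonoidAlgebra.mapDomainAlgHom O O
    (ZMod.unitsMap (pow_dvd_pow p n.le_succ)) (f (n + 1)) = f n}
  mul_mem' hf hg n := by simp only [Pi.mul_apply, map_mul, hf n, hg n]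
  add_mem' hf hg n := by simp only [Pi.add_apply, map_add, hf n, hg n]
  algebraMap_mem' r n := by simp only [Pi.algebraMap_apply, AlgHom.commutes]

section LSymbol

variable {O : Type v} {A R : Type u}
    [CommRing O] [IsDomain O] [IsDiscreteValuationRing O] [IsAdicComplete (maximalIdeal O) O]
    [CommRing A] [IsLocalRing A] [IsNoetherianRing A] [IsAdicComplete (maximalIdeal A) A]
    [Algebra O A] [Module.Flat O A]
    [CommRing R] [IsLocalRing R] [Algebra A R]

/-- An *`L`-symbol setup* `(X, φ, x, ℒ)` for a single-Eisenstein Hecke algebra setup. The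
`R`-module structure on `Hom_A(R, A)` is `(r • g) s = g (r * s)`, and `Hom_A(R⁰, A)` is regarded as
the set of functionals on `R` that factor through `R → R⁰`. -/
structure LSymbolSetup (S : SingleEisensteinSetup O A R) (p : ℕ) (X : Type w)
    [AddCommGroup X] [Module O X] [Module A X] [Module R X]
    [IsScalarTower O A X] [IsScalarTower A R X] where
  /-- The functional `φ`; its kernel is `X⁰`. -/
  φ : X →ₗ[A] A
  /-- The distinguished element. -/
  x : X
  φ_x : φ x = 1
  /-- The `L`-symbol. -/
  ℒ : (LinearMap.ker φ) ⊗[O] (CompletedGroupRing p O)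
  exists_equiv : ∃ f : X ≃ₗ[A] (R →ₗ[A] A),
    (∀ (r : R) (y : X) (s : R), f (r • y) s = f y (r * s)) ∧
    ∀ y : X, y ∈ LinearMap.ker φ ↔
      ∃ g : S.R0 →ₗ[A] A, ∀ s : R, f y s = g (Ideal.Quotient.mk S.I.annihilator s)

namespace LSymbolSetup

variable {S : SingleEisensteinSetup O A R} {p : ℕ} {X : Type w}
    [AddCommGroup X] [Module O X] [Module A X] [Module R X]
    [IsScalarTower O A X] [IsScalarTower A R X]
    (T : LSymbolSetup S p X)

/-- The `R`-submodule `X⁰ = ker φ` of `X`. -/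
def X0 : Submodule R X where
  carrier := {y | T.φ y = 0}
  add_mem' {a b} ha hb := by
    change T.φ (a + b) = 0
    rw [map_add, show T.φ a = 0 from ha, show T.φ b = 0 from hb, add_zero]
  zero_mem' := map_zero T.φ
  smul_mem' r y hy := by
    obtain ⟨f, hf, hker⟩ := T.exists_equiv
    obtain ⟨g, hg⟩ := (hker y).1 hy
    refine (hker (r • y)).2
      ⟨g ∘ₗ LinearMap.mulLeft A (Ideal.Quotient.mk S.I.annihilator r), fun s => ?_⟩
    rw [hf, hg, map_mul, LinearMap.comp_apply, LinearMap.mulLeft_apply]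

theorem X0_isTorsionBySet : Module.IsTorsionBySet R T.X0 (S.I.annihilator : Set R) := by
  rintro ⟨y, hy⟩ ⟨j, hj⟩
  obtain ⟨f, hf, hker⟩ := T.exists_equiv
  obtain ⟨g, hg⟩ := (hker y).1 hy
  apply Subtype.ext
  change j • y = 0
  apply f.injective
  ext s
  rw [hf, hg, Ideal.Quotient.eq_zero_iff_mem.2 (Ideal.mul_mem_right s _ hj), map_zero, map_zero,
    LinearMap.zero_apply]

/-- The action of `R` on `X⁰` factors through `R⁰`. -/
noncomputable instance moduleX0 : Module S.R0 T.X0 := T.X0_isTorsionBySet.module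

/-- The element `t • x` lies in `X⁰` and generates `X⁰` as an `R⁰`-module. -/
def SmulGenerates (t : R) : Prop :=
  ∃ h : t • T.x ∈ T.X0, Submodule.span S.R0 {(⟨t • T.x, h⟩ : T.X0)} = ⊤

end LSymbolSetup

end LSymbol

/-! ### Vanishing of `Ext` and injective dimension -/

section ExtVanishing

open Abelian

variable {B : Type u} [CommRing B]

/-! Since `eis r₀` is a nonzerodivisor, I meets Ann(I) = A r₀ only in 0, so I → I⁰ is bijective and
generators lift; a generator of I has annihilator Ann(I), which makes I free of rank one over R⁰.

If I = (t), then R = A + tR because `eis` splits A → R. Since t is nilpotent modulo 𝔪_A R, Nakayama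
gives R = A[t], and likewise for R⁰. A finite free monogenic algebra is A[X]/(f) with f monic, and
such an algebra over a complete intersection is one too
(`isLocalCompleteIntersectionRing_of_adjoin_singleton`).

Complete intersections are Gorenstein. A regular local ring has finite injective dimension because
its residue field k has finite projective dimension, and this survives division by a regular
sequence. The type is read off a socle: Extᵈ(k, M) is the socle of M modulo any regular sequence of
length d, so the sequence may be changed freely.

If a finite free local A-algebra B is Gorenstein, some functional τ makes b ↦ τ(b ·) an isomorphism
B ≅ Hom_A(B, A) (`exists_bijective_trace_form`): the closed fibre has simple socle, and τ only has
to be nonzero on it. Given such τ on R and τ₀ on R⁰, the pullback of τ₀ to R is τ(t ·) for some t,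
and t generates I: for i in I, τ(i ·) kills Ann(I), so it is the pullback of some τ₀(c ·), whence i
= ct.

As for X ≅ Hom_A(R, A): when R is Gorenstein, X is cyclic, and φ(x) = 1 makes x a generator, so X⁰ =
Ix. Conversely, if tx generates X⁰, then X = Ax + X⁰ = Rx, and faithfulness of X turns ix = ctx into
i = ct. -/

theorem subsingleton_ext_of_shortExact {S : ShortComplex (ModuleCat.{u} B)} (hS : S.ShortExact)
    (M : ModuleCat.{u} B) (i : ℕ) (h₁ : Subsingleton (Ext S.X₁ M i))
    (h₃ : Subsingleton (Ext S.X₃ M i)) : Subsingleton (Ext S.X₂ M i) := by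
  refine subsingleton_of_forall_eq 0 fun x => ?_
  obtain ⟨y, rfl⟩ := Ext.contravariant_sequence_exact₂ hS M x (Subsingleton.elim _ _)
  rw [Subsingleton.elim y 0, Ext.comp_zero]

theorem subsingleton_ext_of_subsingleton (N M : ModuleCat.{u} B) [Subsingleton N] (i : ℕ) :
    Subsingleton (Ext N M i) := by
  refine subsingleton_of_forall_eq 0 fun x => ?_
  rw [← Ext.mk₀_id_comp x, (ModuleCat.isZero_of_subsingleton N).eq_zero_of_src (𝟙 N),
    Ext.mk₀_zero, Ext.zero_comp]

/-- The complex `B ⧸ J → B ⧸ I → B ⧸ (I + (a))` whose first map is multiplication by `a`, where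
`J = (I : a)`. -/
noncomputable abbrev quotientColonComplex (I J : Ideal B) (a : B) (hJ : ∀ b, b ∈ J ↔ a * b ∈ I) :
    ShortComplex (ModuleCat.{u} B) :=
  ModuleCat.shortComplexOfCompEqZero
    (Submodule.mapQ J I (LinearMap.lsmul B B a) fun b hb => (hJ b).1 hb)
    (Submodule.factor (le_sup_left : I ≤ I ⊔ Ideal.span {a}))
    (Submodule.linearMap_qext _ <| LinearMap.ext fun b => by
      refine (Submodule.Quotient.mk_eq_zero _).2 (Ideal.mem_sup_right ?_)
      exact Ideal.mul_mem_right _ _ (Ideal.mem_span_singleton_self a))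

theorem quotientColonComplex_shortExact (I J : Ideal B) (a : B) (hJ : ∀ b, b ∈ J ↔ a * b ∈ I) :
    (quotientColonComplex I J a hJ).ShortExact := by
  refine ModuleCat.shortComplex_shortExact _ ?_ ?_ ?_
  · intro y
    constructor
    · obtain ⟨y, rfl⟩ := Submodule.Quotient.mk_surjective _ y
      intro hy
      obtain ⟨i, hi, z, hz, rfl⟩ := Submodule.mem_sup.1 ((Submodule.Quotient.mk_eq_zero _).1 hy)
      obtain ⟨c, rfl⟩ := Ideal.mem_span_singleton.1 hz
      refine ⟨Submodule.Quotient.mk c, (Submodule.Quotient.eq _).2 ?_⟩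
      simpa using I.neg_mem hi
    · rintro ⟨z, rfl⟩
      exact (quotientColonComplex I J a hJ).moduleCat_zero_apply z
  · refine (injective_iff_map_eq_zero
      (Submodule.mapQ J I (LinearMap.lsmul B B a) fun b hb => (hJ b).1 hb)).2 fun y hy => ?_
    obtain ⟨y, rfl⟩ := Submodule.Quotient.mk_surjective _ y
    exact (Submodule.Quotient.mk_eq_zero _).2 ((hJ y).2 ((Submodule.Quotient.mk_eq_zero _).1 hy))
  · exact Submodule.factor_surjective (le_sup_left : I ≤ I ⊔ Ideal.span {a})

/-- If `Ext^i(k, M)` vanishes for all `i > n`, then so does `Ext^i(B ⧸ I, M)` for every ideal `I`. -/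
theorem subsingleton_ext_quotient_of_residueField [IsLocalRing B] [IsNoetherianRing B]
    (M : ModuleCat.{u} B) [Module.Finite B M] {n : ℕ}
    (h : ∀ i > n, Subsingleton (Ext (ModuleCat.of B (ResidueField B)) M i)) (I : Ideal B) :
    ∀ i > n, Subsingleton (Ext (ModuleCat.of B (B ⧸ I)) M i) := by
  induction I using IsNoetherian.induction with
  | hgt I ih =>
  change Ideal B at I
  intro i hi
  have sup_gt : ∀ a ∉ I, I < I ⊔ Ideal.span {a} := fun a ha =>
    lt_of_le_of_ne le_sup_left fun e =>
      ha (e ▸ Ideal.mem_sup_right (Ideal.mem_span_singleton_self a))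
  by_cases htop : I = ⊤
  · have : Subsingleton (ModuleCat.of B (B ⧸ I)) := Ideal.Quotient.subsingleton_iff.2 htop
    exact subsingleton_ext_of_subsingleton _ _ _
  by_cases hp : I.IsPrime
  · by_cases hmax : I = maximalIdeal B
    · subst hmax
      exact h i hi
    obtain ⟨a, ham, haI⟩ := SetLike.exists_of_lt (lt_of_le_of_ne (le_maximalIdeal htop) hmax)
    have hJ : ∀ b, b ∈ I ↔ a * b ∈ I := fun b =>
      ⟨fun hb => I.mul_mem_left a hb, fun hb => (hp.mem_or_mem hb).resolve_left haI⟩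
    have hS := quotientColonComplex_shortExact I I a hJ
    have hvan : Subsingleton (Ext (quotientColonComplex I I a hJ).X₃ M (i + 1)) :=
      ih _ (sup_gt a haI) (i + 1) (by omega)
    have hf : (quotientColonComplex I I a hJ).f = a • 𝟙 (ModuleCat.of B (B ⧸ I)) := by
      ext
      rfl
    -- Multiplication by a is surjective on Ext^i(B ⧸ I, M), as its cokernel embeds in Ext^(i+1)(B ⧸
    -- (I + (a)), M) = 0. The module is finite and a lies in the maximal ideal, so Nakayama kills
    -- it.
    have htop_le : (⊤ : Submodule B (Ext (ModuleCat.of B (B ⧸ I)) M i)) ≤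
        maximalIdeal B • ⊤ := by
      intro x _
      obtain ⟨y, hy⟩ := Ext.contravariant_sequence_exact₁ hS M x (add_comm 1 i)
        (Subsingleton.elim _ _)
      rw [hf, Ext.mk₀_smul, Ext.smul_comp, Ext.mk₀_id_comp] at hy
      rw [← hy]
      exact Submodule.smul_mem_smul ham trivial
    have := Submodule.eq_bot_of_le_smul_of_le_jacobson_bot _ _ (Module.Finite.fg_top) htop_le
      (maximalIdeal_le_jacobson _)
    exact (Submodule.subsingleton_iff B).1 (subsingleton_of_bot_eq_top this.symm)
  · obtain ⟨a, haI, b, hbI, hab⟩ : ∃ a ∉ I, ∃ b ∉ I, a * b ∈ I := by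
      rw [Ideal.isPrime_iff] at hp
      push Not at hp
      obtain ⟨a, b, hab, ha, hb⟩ := hp htop
      exact ⟨a, ha, b, hb, hab⟩
    let J : Ideal B := Submodule.comap (LinearMap.lsmul B B a) I
    have hJ : ∀ b, b ∈ J ↔ a * b ∈ I := fun b => Iff.rfl
    have hIJ : I < J := lt_of_le_of_ne (fun c hc => I.mul_mem_left a hc) fun e => hbI (e ▸ hab)
    exact subsingleton_ext_of_shortExact (quotientColonComplex_shortExact I J a hJ) M i
      (ih J hIJ i hi) (ih _ (sup_gt a haI) i hi)

/-- Injective dimension is detected by cyclic modules. -/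
theorem hasInjectiveDimensionLE_of_subsingleton_ext_quotient (M : ModuleCat.{u} B) (n : ℕ)
    (h : ∀ I : Ideal B, Subsingleton (Ext (ModuleCat.of B (B ⧸ I)) M (n + 1))) :
    HasInjectiveDimensionLE M n := by
  induction n generalizing M with
  | zero =>
    rw [HasInjectiveDimensionLE, zero_add, ← injective_iff_hasInjectiveDimensionLT_one,
      ← Module.injective_iff_injective_object B M, ← Module.Baer.iff_injective]
    -- Baer's criterion: the obstruction to extending g from I to B lies in Ext¹(B ⧸ I, M).
    intro I g
    have hS := LinearMap.shortExact_shortComplexKer (Submodule.mkQ_surjective I)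
    let e : (LinearMap.ker I.mkQ) ≃ₗ[B] I := LinearEquiv.ofEq _ _ (Submodule.ker_mkQ I)
    have := h I
    obtain ⟨x, hx⟩ := Ext.contravariant_sequence_exact₁ hS M
      (Ext.mk₀ (ModuleCat.ofHom (g ∘ₗ e.toLinearMap))) (add_comm 1 0)
      (@Subsingleton.elim _ (h I) _ _)
    obtain ⟨f, rfl⟩ := (Ext.mk₀_bijective _ _).2 x
    rw [Ext.mk₀_comp_mk₀, (Ext.mk₀_bijective _ _).1.eq_iff] at hx
    refine ⟨f.hom, fun y hy => ?_⟩
    exact LinearMap.congr_fun (congrArg ModuleCat.Hom.hom hx) (e.symm ⟨y, hy⟩)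
  | succ n ih =>
    obtain ⟨E, _, f, _⟩ := EnoughInjectives.presentation M
    let S : ShortComplex (ModuleCat.{u} B) :=
      ModuleCat.shortComplexOfCompEqZero _ _ f.hom.exact_map_mkQ_range.linearMap_comp_eq_zero
    have hS : S.ShortExact := ModuleCat.shortComplex_shortExact S
      f.hom.exact_map_mkQ_range ((ModuleCat.mono_iff_injective f).1 ‹_›)
      (Submodule.mkQ_surjective _)
    refine (hS.hasInjectiveDimensionLT_X₃_iff n ‹_›).1 (ih S.X₃ fun I => ?_)
    refine subsingleton_of_forall_eq 0 fun x => ?_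
    obtain ⟨y, rfl⟩ := Ext.covariant_sequence_exact₃ _ hS x (rfl : n + 1 + 1 = _)
      (@Subsingleton.elim _ (h I) _ _)
    have hE : Injective S.X₂ := ‹_›
    rw [Ext.eq_zero_of_injective y, Ext.zero_comp]

end ExtVanishing

/-! ### Ext from the residue field and regular sequences -/

section ExtRegular

open Abelian RingTheory.Sequence

variable {B : Type u} [CommRing B] [IsLocalRing B]

theorem support_residueField_subset :
    Module.support B (ResidueField B) ⊆ PrimeSpectrum.zeroLocus (maximalIdeal B) := by
  have : Module.annihilator B (ResidueField B) = maximalIdeal B :=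
    Ideal.annihilator_quotient
  rw [Module.support_eq_zeroLocus, this]

theorem maximalIdeal_smul_top_lt (M : Type u) [AddCommGroup M] [Module B M] [Module.Finite B M]
    [Nontrivial M] : maximalIdeal B • (⊤ : Submodule B M) < ⊤ :=
  lt_top_iff_ne_top.2 fun h => bot_ne_top (Submodule.eq_bot_of_le_smul_of_le_jacobson_bot _ _
    Module.Finite.fg_top h.ge (maximalIdeal_le_jacobson _)).symm

theorem subsingleton_ext_residueField_of_isRegular [IsNoetherianRing B] (M : ModuleCat.{u} B)
    [Module.Finite B M] (rs : List B) (hmem : ∀ r ∈ rs, r ∈ maximalIdeal B)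
    (hreg : IsRegular M rs) :
    ∀ i < rs.length, Subsingleton (Ext (ModuleCat.of B (ResidueField B)) M i) :=
  have := hreg.nontrivial
  ModuleCat.subsingleton_ext_of_exists_isRegular (maximalIdeal B) _ support_residueField_subset M
    (maximalIdeal_smul_top_lt M) rs hmem hreg

/-- For a regular sequence of length `d`, the module `Ext^d(k, M)` is the socle of the quotient. -/
theorem nonempty_ext_length_equiv [IsNoetherianRing B] (M : ModuleCat.{u} B) [Module.Finite B M]
    (rs : List B) (hmem : ∀ r ∈ rs, r ∈ maximalIdeal B) (hreg : IsRegular M rs) :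
    Nonempty (Ext (ModuleCat.of B (ResidueField B)) M rs.length ≃ₗ[B]
      (ResidueField B →ₗ[B] M ⧸ (Ideal.ofList rs • ⊤ : Submodule B M))) := by
  induction rs generalizing M with
  | nil =>
    have h0 : (Ideal.ofList ([] : List B) • ⊤ : Submodule B M) = ⊥ := by
      rw [Ideal.ofList_nil, Submodule.bot_smul]
    have e : M ≃ₗ[B] M ⧸ (Ideal.ofList ([] : List B) • ⊤ : Submodule B M) :=
      (Submodule.quotEquivOfEqBot _ h0).symm
    exact ⟨(Ext.linearEquiv₀.trans ModuleCat.homLinearEquiv).trans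
      (LinearEquiv.congrRight e)⟩
  | cons a rs ih =>
    have hreg' := (isRegular_cons_iff _ _ _).1 hreg
    have hS := hreg'.1.smulShortComplex_shortExact
    let M' : ModuleCat.{u} B := ModuleCat.of B (QuotSMulTop a M)
    obtain ⟨e⟩ := ih M' (fun r hr => hmem r (List.mem_cons_of_mem _ hr)) hreg'.2
    have hvan := subsingleton_ext_residueField_of_isRegular M (a :: rs) hmem hreg rs.length
      (by simp)
    have ha : a ∈ Module.annihilator B (ResidueField B) := by
      rw [show Module.annihilator B (ResidueField B) = maximalIdeal B from
        Ideal.annihilator_quotient]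
      exact hmem a List.mem_cons_self
    have hid : a • 𝟙 (ModuleCat.of B (ResidueField B)) = 0 := by
      ext
      exact Module.mem_annihilator.1 ha _
    -- The connecting map is injective because the preceding group Ext^|rs|(k, M) vanishes, and
    -- surjective because a kills k, hence also Ext(k, M).
    let δ : Ext (ModuleCat.of B (ResidueField B)) M' rs.length →ₗ[B]
        Ext (ModuleCat.of B (ResidueField B)) M (rs.length + 1) :=
      hS.extClass.postcompOfLinear B _ rfl
    have hinj : Function.Injective δ := by
      refine (injective_iff_map_eq_zero δ).2 fun x hx => ?_
      obtain ⟨y, rfl⟩ := Ext.covariant_sequence_exact₃ _ hS x rfl hx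
      have hy : y = 0 := @Subsingleton.elim _ hvan y 0
      subst hy
      exact Ext.zero_comp _ _ _ _ _
    have hsurj : Function.Surjective δ := by
      intro x
      have hax : a • x = 0 := by
        rw [← Ext.mk₀_id_comp x, ← Ext.smul_comp, ← Ext.mk₀_smul, hid, Ext.mk₀_zero, Ext.zero_comp]
      exact Ext.covariant_sequence_exact₁ _ hS x ((Ext.smul_eq_comp_mk₀ x a).symm.trans hax) rfl
    exact ⟨((LinearEquiv.ofBijective δ ⟨hinj, hsurj⟩).symm.trans e).trans (LinearEquiv.congrRight
      (Submodule.quotOfListConsSMulTopEquivQuotSMulTopInner M a rs).symm)⟩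

end ExtRegular

/-! ### Injective dimension modulo a regular element -/

section InjectiveTorsion

open scoped Pointwise

variable {B C : Type u} [CommRing B] [CommRing C] [Algebra B C]

/-- Let `B → C` be surjective with kernel `(x)`. If `D` is the `x`-torsion of an injective
`B`-module, then `D` is an injective `C`-module. -/
theorem injective_of_range_eq_torsionBy (hBC : Function.Surjective (algebraMap B C)) {x : B}
    (hx : algebraMap B C x = 0) {E D : Type u} [AddCommGroup E] [Module B E] [AddCommGroup D]
    [Module B D] [Module C D] [IsScalarTower B C D] (j : D →ₗ[B] E) (hj : Function.Injective j)
    (hrange : LinearMap.range j = Submodule.torsionBy B E x) [Module.Injective B E] :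
    Module.Injective C D := by
  refine ⟨fun X Y _ _ _ _ f hf g => ?_⟩
  let := Module.compHom X (algebraMap B C)
  let := Module.compHom Y (algebraMap B C)
  have : IsScalarTower B C X := ⟨fun b c y => by
    rw [Algebra.smul_def, mul_smul]; rfl⟩
  have : IsScalarTower B C Y := ⟨fun b c y => by
    rw [Algebra.smul_def, mul_smul]; rfl⟩
  obtain ⟨h, hh⟩ := Module.Injective.out (Q := E) (f.restrictScalars B) hf
    (j ∘ₗ g.restrictScalars B)
  have hmem : ∀ y, h y ∈ LinearMap.range j := fun y => by
    rw [hrange, Submodule.mem_torsionBy_iff, ← map_smul, ← algebraMap_smul C, hx, zero_smul,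
      map_zero]
  let h' : Y →ₗ[B] D := (LinearEquiv.ofInjective j hj).symm.toLinearMap ∘ₗ h.codRestrict _ hmem
  have hjh' : ∀ y, j (h' y) = h y := fun y =>
    congrArg Subtype.val ((LinearEquiv.ofInjective j hj).apply_symm_apply ⟨h y, hmem y⟩)
  refine ⟨{ toFun := h', map_add' := h'.map_add, map_smul' := fun c y => ?_ }, fun y => hj ?_⟩
  · obtain ⟨b, rfl⟩ := hBC c
    rw [algebraMap_smul, map_smul, RingHom.id_apply, algebraMap_smul]
  · exact (hjh' _).trans (hh y)

/-- The map 1 ↦ e extends along multiplication by x, which is injective on B; the extension takes 1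
to the required e'. -/
theorem Module.Injective.exists_smul_eq {E : Type u} [AddCommGroup E] [Module B E]
    [Module.Injective B E] {x : B} (hx : x ∈ nonZeroDivisors B) (e : E) : ∃ e', x • e' = e := by
  obtain ⟨h, hh⟩ := Module.Injective.out (Q := E) (LinearMap.lsmul B B x)
    (fun a b hab => by
      have : (a - b) * x = 0 := by
        have hab' : x * a = x * b := hab
        linear_combination hab'
      exact sub_eq_zero.1 ((mem_nonZeroDivisors_iff_right.1 hx) _ this))
    (LinearMap.toSpanSingleton B E e)
  refine ⟨h 1, ?_⟩
  rw [← map_smul]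
  simpa using hh 1

/-- The map on `x`-torsion induced by a linear map. -/
noncomputable def torsionByMap (x : B) {E F : Type u} [AddCommGroup E] [Module B E]
    [AddCommGroup F] [Module B F] (f : E →ₗ[B] F) :
    Submodule.torsionBy B E x →ₗ[B ⧸ Ideal.span {x}] Submodule.torsionBy B F x :=
  LinearMap.extendScalarsOfSurjective (R := B) Ideal.Quotient.mk_surjective
    (f.restrict fun e he => by
      rw [Submodule.mem_torsionBy_iff] at he ⊢
      rw [← map_smul, he, map_zero])

theorem injective_torsionBy (x : B) (E : Type u) [AddCommGroup E] [Module B E]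
    (hE : Injective (ModuleCat.of B E)) :
    Injective (ModuleCat.of (B ⧸ Ideal.span {x}) (Submodule.torsionBy B E x)) := by
  have : Module.Injective B E := Module.injective_module_of_injective_object B E
  have hx : algebraMap B (B ⧸ Ideal.span {x}) x = 0 :=
    Ideal.Quotient.eq_zero_iff_mem.2 (Ideal.mem_span_singleton_self x)
  have := injective_of_range_eq_torsionBy Ideal.Quotient.mk_surjective hx
    (Submodule.torsionBy B E x).subtype (Submodule.subtype_injective _)
    (Submodule.range_subtype _)
  exact (Module.injective_iff_injective_object _ _).1 this

theorem exact_torsionByMap {x : B} {E F Q : Type u} [AddCommGroup E] [Module B E]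
    [AddCommGroup F] [Module B F] [AddCommGroup Q] [Module B Q] {f : E →ₗ[B] F} {g : F →ₗ[B] Q}
    (hf : Function.Injective f) (hfg : Function.Exact f g) :
    Function.Exact (torsionByMap x f) (torsionByMap x g) := by
  intro y
  constructor
  · intro hy
    obtain ⟨e, he⟩ := (hfg y).1 (congrArg Subtype.val hy)
    refine ⟨⟨e, ?_⟩, Subtype.ext he⟩
    rw [Submodule.mem_torsionBy_iff]
    apply hf
    rw [map_smul, he, Submodule.smul_coe_torsionBy, map_zero]
  · rintro ⟨e, rfl⟩
    exact Subtype.ext (hfg.apply_apply_eq_zero _)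

/-- The `x`-torsion of an `x`-divisible module `E` has injective dimension over `B ⧸ (x)` at most
that of `E` over `B`. -/
theorem hasInjectiveDimensionLE_torsionBy {x : B} (hx : x ∈ nonZeroDivisors B) (n : ℕ)
    (E : Type u) [AddCommGroup E] [Module B E] (hdiv : ∀ e : E, ∃ e', x • e' = e)
    [hE : HasInjectiveDimensionLE (ModuleCat.of B E) n] :
    HasInjectiveDimensionLE (ModuleCat.of (B ⧸ Ideal.span {x}) (Submodule.torsionBy B E x)) n := by
  induction n generalizing E with
  | zero =>
    rw [HasInjectiveDimensionLE, zero_add, ← injective_iff_hasInjectiveDimensionLT_one] at hE ⊢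
    exact injective_torsionBy x E hE
  | succ n ih =>
    obtain ⟨F, hF, f, _⟩ := EnoughInjectives.presentation (ModuleCat.of B E)
    have hf : Function.Injective f.hom := (ModuleCat.mono_iff_injective f).1 ‹_›
    have hFmod : Module.Injective B F := Module.injective_module_of_injective_object B F
    let Q := F ⧸ LinearMap.range f.hom
    let S : ShortComplex (ModuleCat.{u} B) :=
      ModuleCat.shortComplexOfCompEqZero _ _ f.hom.exact_map_mkQ_range.linearMap_comp_eq_zero
    have hS : S.ShortExact := ModuleCat.shortComplex_shortExact S
      f.hom.exact_map_mkQ_range hf (Submodule.mkQ_surjective _)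
    have hQ : HasInjectiveDimensionLE (ModuleCat.of B Q) n :=
      (hS.hasInjectiveDimensionLT_X₃_iff n hF).2 hE
    have hQdiv : ∀ q : Q, ∃ q', x • q' = q := fun q => by
      obtain ⟨y, rfl⟩ := Submodule.Quotient.mk_surjective _ q
      obtain ⟨y', rfl⟩ := Module.Injective.exists_smul_eq hx y
      exact ⟨Submodule.Quotient.mk y', rfl⟩
    have hD := ih Q hQdiv
    have hex := exact_torsionByMap (x := x) hf f.hom.exact_map_mkQ_range
    let T : ShortComplex (ModuleCat.{u} (B ⧸ Ideal.span {x})) :=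
      ModuleCat.shortComplexOfCompEqZero (torsionByMap x f.hom)
        (torsionByMap x (LinearMap.range f.hom).mkQ) hex.linearMap_comp_eq_zero
    have hT : T.ShortExact := by
      refine ModuleCat.shortComplex_shortExact T hex
        (fun a b hab => Subtype.ext (hf (congrArg Subtype.val hab))) ?_
      -- Divisibility of E enters here: if x y comes from x e' in E, then y - f(e') is an x-torsion
      -- lift of q.
      rintro ⟨q, hq⟩
      obtain ⟨y, rfl⟩ := Submodule.Quotient.mk_surjective _ q
      rw [Submodule.mem_torsionBy_iff] at hq
      obtain ⟨e, he⟩ : x • y ∈ LinearMap.range f.hom :=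
        (Submodule.Quotient.mk_eq_zero _).1 hq
      obtain ⟨e', rfl⟩ := hdiv e
      refine ⟨⟨y - f.hom e', ?_⟩, Subtype.ext ((Submodule.Quotient.eq _).2 ⟨-e', ?_⟩)⟩
      · rw [Submodule.mem_torsionBy_iff, smul_sub, ← map_smul, he, sub_self]
      · simp
    exact (hT.hasInjectiveDimensionLT_X₃_iff n (injective_torsionBy x F hF)).1 hD

/-- Passing to the quotient by a regular element lowers a positive bound on the injective
dimension. -/
theorem hasInjectiveDimensionLE_quotSMulTop {x : B} (hx : x ∈ nonZeroDivisors B) (n : ℕ)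
    (M : Type u) [AddCommGroup M] [Module B M] (hreg : IsSMulRegular M x)
    [hM : HasInjectiveDimensionLE (ModuleCat.of B M) (n + 1)] :
    HasInjectiveDimensionLE (ModuleCat.of (B ⧸ Ideal.span {x}) (QuotSMulTop x M)) n := by
  obtain ⟨F, hF, f, _⟩ := EnoughInjectives.presentation (ModuleCat.of B M)
  have hf : Function.Injective f.hom := (ModuleCat.mono_iff_injective f).1 ‹_›
  have hFmod : Module.Injective B F := Module.injective_module_of_injective_object B F
  let Q := F ⧸ LinearMap.range f.hom
  let S : ShortComplex (ModuleCat.{u} B) :=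
    ModuleCat.shortComplexOfCompEqZero _ _ f.hom.exact_map_mkQ_range.linearMap_comp_eq_zero
  have hS : S.ShortExact := ModuleCat.shortComplex_shortExact S
    f.hom.exact_map_mkQ_range hf (Submodule.mkQ_surjective _)
  have hQ : HasInjectiveDimensionLE (ModuleCat.of B Q) n :=
    (hS.hasInjectiveDimensionLT_X₃_iff n hF).2 hM
  have hQdiv : ∀ q : Q, ∃ q', x • q' = q := fun q => by
    obtain ⟨y, rfl⟩ := Submodule.Quotient.mk_surjective _ q
    obtain ⟨y', rfl⟩ := Module.Injective.exists_smul_eq hx y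
    exact ⟨Submodule.Quotient.mk y', rfl⟩
  have hD := hasInjectiveDimensionLE_torsionBy hx n Q hQdiv
  -- Snake lemma for multiplication by x gives 0 → F[x] → Q[x] → M/xM → 0. The connecting map g
  -- lifts a torsion class to P, multiplies by x to land in M (this is μ), and reduces modulo x.
  let P : Submodule B F := (LinearMap.range f.hom).comap (LinearMap.lsmul B F x)
  let μ : P →ₗ[B] M := (LinearEquiv.ofInjective f.hom hf).symm.toLinearMap ∘ₗ
    (LinearMap.lsmul B F x).restrict (p := P) (q := LinearMap.range f.hom) fun _ h => h
  have hμ : ∀ e : P, f.hom (μ e) = x • (e : F) := fun e =>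
    congrArg Subtype.val ((LinearEquiv.ofInjective f.hom hf).apply_symm_apply _)
  let p : P →ₗ[B] QuotSMulTop x M := Submodule.mkQ _ ∘ₗ μ
  let q : P →ₗ[B] Submodule.torsionBy B Q x :=
    (LinearMap.range f.hom).mkQ.restrict fun e he =>
      (Submodule.mem_torsionBy_iff _ _).2 ((Submodule.Quotient.mk_eq_zero _).2 he)
  have hq : Function.Surjective q := by
    rintro ⟨y, hy⟩
    obtain ⟨y, rfl⟩ := Submodule.Quotient.mk_surjective _ y
    exact ⟨⟨y, (Submodule.Quotient.mk_eq_zero (LinearMap.range f.hom)).1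
      ((Submodule.mem_torsionBy_iff _ _).1 hy)⟩, rfl⟩
  have hqp : LinearMap.ker q ≤ LinearMap.ker p := by
    intro e he
    obtain ⟨m, hm⟩ : (e : F) ∈ LinearMap.range f.hom :=
      (Submodule.Quotient.mk_eq_zero _).1 (congrArg Subtype.val he)
    have : μ e = x • m := hf (by rw [hμ, map_smul, hm])
    refine (Submodule.Quotient.mk_eq_zero _).2 ?_
    rw [this]
    exact Submodule.smul_mem_pointwise_smul _ _ _ trivial
  let g : Submodule.torsionBy B Q x →ₗ[B] QuotSMulTop x M :=
    (LinearMap.ker q).liftQ p hqp ∘ₗ (q.quotKerEquivOfSurjective hq).symm.toLinearMap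
  have hg : ∀ e, g (q e) = p e := fun e => by
    have : (q.quotKerEquivOfSurjective hq).symm (q e) = Submodule.Quotient.mk e := by
      rw [LinearEquiv.symm_apply_eq]
      rfl
    change (LinearMap.ker q).liftQ p hqp ((q.quotKerEquivOfSurjective hq).symm (q e)) = _
    rw [this]
    rfl
  let g' : Submodule.torsionBy B Q x →ₗ[B ⧸ Ideal.span {x}] QuotSMulTop x M :=
    g.extendScalarsOfSurjective Ideal.Quotient.mk_surjective
  have hex : Function.Exact (torsionByMap x (LinearMap.range f.hom).mkQ) g' := by
    intro y
    obtain ⟨e, rfl⟩ := hq y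
    constructor
    · intro h
      have h' : Submodule.mkQ (x • (⊤ : Submodule B M)) (μ e) = 0 := (hg e).symm.trans h
      rw [Submodule.mkQ_apply, Submodule.Quotient.mk_eq_zero,
        Submodule.mem_smul_pointwise_iff_exists] at h'
      obtain ⟨m, -, hm⟩ := h'
      refine ⟨⟨e - f.hom m, ?_⟩, Subtype.ext ((Submodule.Quotient.eq _).2 ⟨-m, ?_⟩)⟩
      · rw [Submodule.mem_torsionBy_iff, smul_sub, ← hμ, ← hm, map_smul, sub_self]
      · simp
    · rintro ⟨e', he'⟩
      have hxe : x • (e' : F) = 0 := Submodule.smul_coe_torsionBy x e'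
      have he'P : (e' : F) ∈ P := by
        change x • (e' : F) ∈ LinearMap.range f.hom
        rw [hxe]
        exact zero_mem _
      have : q e = q ⟨e', he'P⟩ := he'.symm
      rw [this]
      have hμ0 : μ ⟨e', he'P⟩ = 0 := hf (by rw [hμ, map_zero]; exact hxe)
      refine (hg _).trans ?_
      change Submodule.mkQ _ (μ _) = _
      rw [hμ0, map_zero]
  let T : ShortComplex (ModuleCat.{u} (B ⧸ Ideal.span {x})) :=
    ModuleCat.shortComplexOfCompEqZero _ g' hex.linearMap_comp_eq_zero
  have hT : T.ShortExact := by
    refine ModuleCat.shortComplex_shortExact T hex ?_ ?_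
    · refine (injective_iff_map_eq_zero (torsionByMap x (LinearMap.range f.hom).mkQ)).2
        fun e he => ?_
      obtain ⟨m, hm⟩ : (e : F) ∈ LinearMap.range f.hom :=
        (Submodule.Quotient.mk_eq_zero _).1 (congrArg Subtype.val he)
      have hm0 : x • m = x • 0 := hf (by
        rw [map_smul, hm, Submodule.smul_coe_torsionBy, smul_zero, map_zero])
      refine Subtype.ext ?_
      rw [← hm, hreg hm0, map_zero]
      rfl
    · intro y
      obtain ⟨m, rfl⟩ := Submodule.Quotient.mk_surjective _ y
      obtain ⟨e, he⟩ := Module.Injective.exists_smul_eq hx (f.hom m)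
      have heP : e ∈ P := ⟨m, he.symm⟩
      refine ⟨q ⟨e, heP⟩, (hg _).trans ?_⟩
      have : μ ⟨e, heP⟩ = m := hf ((hμ _).trans he)
      change Submodule.mkQ _ (μ _) = _
      rw [this]
      rfl
  have hF' : Injective T.X₁ := injective_torsionBy x F hF
  exact hT.hasInjectiveDimensionLT_X₃ (n + 1) hD (hasInjectiveDimensionLT_of_ge T.X₁ 1 _ (by omega))

end InjectiveTorsion

/-! ### Regular local rings -/

section RegularLocal

open RingTheory.Sequence

theorem IsLocalRing.quotient_span_singleton {S : Type u} [CommRing S] [IsLocalRing S] {x : S}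
    (hx : x ∈ maximalIdeal S) : IsLocalRing (S ⧸ Ideal.span {x}) := by
  have : Nontrivial (S ⧸ Ideal.span {x}) := Ideal.Quotient.nontrivial_iff.2 fun h =>
    hx (Ideal.span_singleton_eq_top.1 h)
  exact IsLocalRing.of_surjective' _ Ideal.Quotient.mk_surjective

/-- The class of x in the cotangent space is nonzero, so it extends to a basis. By Nakayama, x and
lifts of the other basis vectors generate the maximal ideal, and modulo x those lifts suffice. -/
theorem spanFinrank_maximalIdeal_quotient_succ_le {S : Type u} [CommRing S] [IsLocalRing S]
    [IsNoetherianRing S] {x : S} (hx : x ∈ maximalIdeal S) (hx2 : x ∉ maximalIdeal S ^ 2)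
    [IsLocalRing (S ⧸ Ideal.span {x})] :
    (maximalIdeal (S ⧸ Ideal.span {x})).spanFinrank + 1 ≤ (maximalIdeal S).spanFinrank := by
  classical
  let q := (maximalIdeal S).toCotangent
  have hq : Function.Surjective q := Ideal.toCotangent_surjective _
  let v : CotangentSpace S := q ⟨x, hx⟩
  have hv : v ≠ 0 := fun h => hx2 ((Ideal.toCotangent_eq_zero _ _).1 h)
  have hli : LinearIndepOn (ResidueField S) id ({v} : Set (CotangentSpace S)) :=
    LinearIndepOn.singleton hv
  let b := hli.extend (Set.subset_univ _)
  let bas := Module.Basis.extend hli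
  have hvb : v ∈ b := hli.subset_extend _ rfl
  have hfin : Finite b := Module.Finite.finite_basis bas
  have hcard : b.ncard = (maximalIdeal S).spanFinrank := by
    rw [spanFinrank_maximalIdeal_eq_finrank_cotangentSpace,
      Module.finrank_eq_nat_card_basis bas]
    rfl
  let L := Function.surjInv hq
  have hL : ∀ w, q (L w) = w := Function.surjInv_eq hq
  let s : Set (maximalIdeal S) := insert ⟨x, hx⟩ (L '' (b \ {v}))
  have hs : q '' s = b := by
    rw [Set.image_insert_eq, ← Set.image_comp]
    have : (q ∘ L) '' (b \ {v}) = b \ {v} := by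
      rw [show (q ∘ L : _ → _) = id from funext hL, Set.image_id]
    rw [this]
    exact Set.insert_sdiff_self_of_mem hvb
  have hspan : Submodule.span S s = ⊤ := by
    rw [← CotangentSpace.span_image_eq_top_iff, hs]
    have := bas.span_eq
    rwa [Module.Basis.range_extend] at this
  let t : Set S := (fun w => ((L w : maximalIdeal S) : S)) '' (b \ {v})
  have hm : maximalIdeal S = Ideal.span (insert x t) := by
    have := congrArg (Submodule.map (maximalIdeal S).subtype) hspan
    rw [Submodule.map_top, Submodule.range_subtype, Submodule.map_span, Set.image_insert_eq,
      ← Set.image_comp] at this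
    exact this.symm
  have hmbar : maximalIdeal (S ⧸ Ideal.span {x}) =
      Ideal.span (Ideal.Quotient.mk (Ideal.span {x}) '' t) := by
    rw [← map_maximalIdeal_of_surjective (Ideal.Quotient.mk (Ideal.span {x}))
      Ideal.Quotient.mk_surjective, hm, Ideal.map_span, Set.image_insert_eq,
      Ideal.Quotient.eq_zero_iff_mem.2 (Ideal.mem_span_singleton_self x)]
    exact Submodule.span_insert_zero
  have htfin : (b \ {v}).Finite := (Set.toFinite b).sdiff
  have h1 : (maximalIdeal (S ⧸ Ideal.span {x})).spanFinrank ≤ (b \ {v}).ncard := by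
    rw [hmbar]
    refine (Submodule.spanFinrank_span_le_ncard_of_finite ((htfin.image _).image _)).trans ?_
    exact (Set.ncard_image_le (htfin.image _)).trans (Set.ncard_image_le htfin)
  have h2 := Set.ncard_sdiff_singleton_add_one hvb (Set.toFinite b)
  omega

/-- The dimension drops by at most one, the embedding dimension by at least one, and the former
never exceeds the latter; regularity of S forces equality throughout. -/
theorem IsRegularLocalRing.quotient_span_singleton {S : Type u} [CommRing S]
    [IsRegularLocalRing S] {x : S} (hx : x ∈ maximalIdeal S) (hx2 : x ∉ maximalIdeal S ^ 2) :
    IsRegularLocalRing (S ⧸ Ideal.span {x}) ∧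
      ringKrullDim (S ⧸ Ideal.span {x}) + 1 = ringKrullDim S := by
  have := IsLocalRing.quotient_span_singleton hx
  have h1 := spanFinrank_maximalIdeal_quotient_succ_le hx hx2
  have h2 := (isRegularLocalRing_iff S).1 inferInstance
  have h3 : ringKrullDim S ≤ ringKrullDim (S ⧸ Ideal.span {x}) + 1 := by
    have := ringKrullDim_le_ringKrullDim_quotient_add_encard ({x} : Set S) (by
      rw [IsLocalRing.ringJacobson_eq_maximalIdeal]
      simpa using hx)
    simpa using this
  have h4 := ringKrullDim_le_spanFinrank_maximalIdeal (S ⧸ Ideal.span {x})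
  have h5 : ringKrullDim (S ⧸ Ideal.span {x}) + 1 = ringKrullDim S := by
    refine le_antisymm ?_ h3
    rw [← h2]
    refine (add_le_add_left h4 1).trans ?_
    exact_mod_cast h1
  refine ⟨IsRegularLocalRing.of_spanFinrank_maximalIdeal_le _ ?_, h5⟩
  rw [← h2] at h5
  have h6 : ((maximalIdeal (S ⧸ Ideal.span {x})).spanFinrank : WithBot ℕ∞) + 1 ≤
      ringKrullDim (S ⧸ Ideal.span {x}) + 1 := by
    rw [h5]
    exact_mod_cast h1
  exact (ENat.WithBot.add_le_add_one_right_iff).1 h6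

/-- `S / xS` and `S ⧸ (x)` agree as modules over `S ⧸ (x)`. -/
noncomputable def quotSMulTopEquivQuotient {S : Type u} [CommRing S] (x : S) :
    QuotSMulTop x S ≃ₗ[S ⧸ Ideal.span {x}] S ⧸ Ideal.span {x} :=
  LinearEquiv.extendScalarsOfSurjective (R := S) Ideal.Quotient.mk_surjective
    (Submodule.quotEquivOfEq _ _ (by
      rw [← Submodule.ideal_span_singleton_smul, smul_eq_mul, Ideal.mul_top]))

/-- Induction on dimension. Prime avoidance gives x in 𝔪 outside 𝔪² and all minimal primes. By
induction S ⧸ (x) is a domain, so (x) contains a minimal prime p; since x ∉ p, p = xp, and Nakayama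
gives p = 0. A regular generating sequence of the maximal ideal of S ⧸ (x) lifts and is prefixed by
x. -/
theorem IsRegularLocalRing.isDomain_and_exists_isRegular (n : ℕ) :
    ∀ (S : Type u) [CommRing S] [IsRegularLocalRing S], ringKrullDim S = n →
      IsDomain S ∧ ∃ ys : List S, IsRegular S ys ∧ Ideal.ofList ys = maximalIdeal S := by
  induction n with
  | zero =>
    intro S _ _ h
    have h2 := (isRegularLocalRing_iff S).1 inferInstance
    rw [h] at h2
    have hbot : maximalIdeal S = ⊥ :=
      (Submodule.spanFinrank_eq_zero_iff_eq_bot (IsNoetherian.noetherian _)).1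
        (by exact_mod_cast h2)
    exact ⟨(IsLocalRing.isField_iff_maximalIdeal_eq.2 hbot).isDomain, [], IsRegular.nil S S,
      by rw [Ideal.ofList_nil, hbot]⟩
  | succ n ih =>
    intro S _ _ hdim
    have hne : ringKrullDim S ≠ 0 := by
      rw [hdim]
      exact_mod_cast n.succ_ne_zero
    have hsq := IsLocalRing.maximalIdeal_sq_lt_of_ringKrullDim_ne_zero hne
    have hminfin := minimalPrimes.finite_of_isNoetherianRing S
    obtain ⟨x, hxm, hx2, hxmin⟩ : ∃ x ∈ maximalIdeal S, x ∉ maximalIdeal S ^ 2 ∧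
        ∀ p ∈ minimalPrimes S, x ∉ p := by
      by_contra! hcon
      have hsub : (maximalIdeal S : Set S) ⊆ ⋃ i ∈ ((insert (maximalIdeal S ^ 2)
          hminfin.toFinset : Finset (Ideal S)) : Set (Ideal S)), (id i : Ideal S) := by
        intro x hx
        by_cases h : x ∈ maximalIdeal S ^ 2
        · exact Set.mem_biUnion (by simp) h
        · obtain ⟨p, hp, hxp⟩ := hcon x hx h
          exact Set.mem_biUnion (by simp [hp]) hxp
      -- Prime avoidance tolerates two non-prime ideals; 𝔪² fills both places.
      obtain ⟨I, hI, hle⟩ := (Ideal.subset_union_prime (maximalIdeal S ^ 2) (maximalIdeal S ^ 2)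
        (fun i hi h _ => by
          rw [Finset.mem_insert, Set.Finite.mem_toFinset] at hi
          exact (hi.resolve_left h).1.1)).1 hsub
      rw [Finset.mem_insert, Set.Finite.mem_toFinset] at hI
      rcases hI with rfl | hI
      · exact hsq.not_ge hle
      · have hp : I.IsPrime := hI.1.1
        have hIm : I = maximalIdeal S := le_antisymm (le_maximalIdeal hp.ne_top) hle
        have h0 := Ideal.height_eq_zero_iff.2 hI
        have := IsLocalRing.maximalIdeal_height_eq_ringKrullDim (R := S)
        rw [← hIm, h0] at this
        exact hne this.symm
    obtain ⟨hreg, hdim'⟩ := IsRegularLocalRing.quotient_span_singleton hxm hx2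
    rw [hdim] at hdim'
    obtain ⟨hdom, ys, hys, hysm⟩ := ih (S ⧸ Ideal.span {x})
      (le_antisymm (ENat.WithBot.add_le_add_one_right_iff.1 (by rw [hdim']; push_cast; rfl))
        (ENat.WithBot.add_le_add_one_right_iff.1 (by rw [hdim']; push_cast; rfl)))
    have hxp : (Ideal.span {x}).IsPrime := (Ideal.Quotient.isDomain_iff_prime _).1 hdom
    have hSdom : IsDomain S := by
      obtain ⟨p, hp, hpx⟩ := Ideal.exists_minimalPrimes_le (bot_le : ⊥ ≤ Ideal.span {x})
      have hpp : p.IsPrime := hp.1.1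
      have hle : p ≤ maximalIdeal S • p := fun y hy => by
        obtain ⟨z, rfl⟩ := Ideal.mem_span_singleton.1 (hpx hy)
        exact Submodule.smul_mem_smul hxm ((hpp.mem_or_mem hy).resolve_left (hxmin p hp))
      have := Submodule.eq_bot_of_le_smul_of_le_jacobson_bot _ _ (IsNoetherian.noetherian p) hle
        (maximalIdeal_le_jacobson _)
      subst this
      exact IsDomain.of_bot_isPrime S
    have hx0 : x ≠ 0 := fun h => hx2 (h ▸ zero_mem _)
    have hlift : ∃ zs : List S, zs.map (Ideal.Quotient.mk (Ideal.span {x})) = ys :=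
      ⟨ys.map (Function.surjInv Ideal.Quotient.mk_surjective), by
        rw [List.map_map]
        exact (List.map_congr_left fun y _ => Function.surjInv_eq _ y).trans (List.map_id _)⟩
    obtain ⟨zs, rfl⟩ := hlift
    refine ⟨hSdom, x :: zs, ?_, ?_⟩
    · refine (isRegular_cons_iff' _ _ _).2 ⟨?_, ?_⟩
      · exact fun a b hab => mul_left_cancel₀ hx0 hab
      · exact ((quotSMulTopEquivQuotient x).isRegular_congr _).2 hys
    · rw [Ideal.ofList_cons]
      rw [← Ideal.map_ofList, ← map_maximalIdeal_of_surjective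
        (Ideal.Quotient.mk (Ideal.span {x})) Ideal.Quotient.mk_surjective] at hysm
      have := congrArg (Ideal.comap (Ideal.Quotient.mk (Ideal.span {x}))) hysm
      rw [Ideal.comap_map_of_surjective _ Ideal.Quotient.mk_surjective,
        Ideal.comap_map_of_surjective _ Ideal.Quotient.mk_surjective, ← RingHom.ker_eq_comap_bot,
        Ideal.mk_ker] at this
      rw [sup_comm, this, sup_eq_left]
      exact (Ideal.span_singleton_le_iff_mem _).2 hxm

end RegularLocal

/-! ### Complete intersections are Gorenstein -/

section Gorenstein

open Abelian RingTheory.Sequence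

/-- The maximal ideal is generated by a regular sequence, so k has finite projective dimension and
Ext^i(k, S) vanishes for large i. This vanishing spreads to all cyclic modules, which detect
injective dimension. -/
theorem exists_hasInjectiveDimensionLE_of_regularLocal (S : Type u) [CommRing S]
    [IsRegularLocalRing S] : ∃ n : ℕ, HasInjectiveDimensionLE (ModuleCat.of S S) n := by
  obtain ⟨m, hm⟩ : ∃ m : ℕ, ringKrullDim S = m := by
    have := (isRegularLocalRing_iff S).1 inferInstance
    exact ⟨_, this.symm⟩
  obtain ⟨-, ys, hreg, hys⟩ := IsRegularLocalRing.isDomain_and_exists_isRegular m S hm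
  refine ⟨ys.length, hasInjectiveDimensionLE_of_subsingleton_ext_quotient _ _ fun I =>
    subsingleton_ext_quotient_of_residueField (n := ys.length) _ (fun i hi => ?_) I _ (by omega)⟩
  have hmem : ∀ r ∈ ys, r ∈ maximalIdeal S := fun r hr => hys ▸ Ideal.subset_span hr
  have hpd := ModuleCat.projectiveDimension_quotient_eq_add_length_of_isWeaklyRegular
    (ModuleCat.of S S) ys hreg.1 hmem
  have he : (Ideal.ofList ys • ⊤ : Submodule S (ModuleCat.of S S)) = maximalIdeal S := by
    rw [hys]
    exact Ideal.mul_top _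
  have hpd' : projectiveDimension (ModuleCat.of S (ResidueField S)) ≤ ys.length := by
    have hiso := projectiveDimension_eq_of_iso (Submodule.quotEquivOfEq _ _ he).toModuleIso
    refine (hiso.symm.trans hpd).le.trans ?_
    have h0 : projectiveDimension (ModuleCat.of S S) ≤ (0 : ℕ) := by
      rw [projectiveDimension_le_iff, HasProjectiveDimensionLE, zero_add,
        ← projective_iff_hasProjectiveDimensionLT_one, ← IsProjective.iff_projective]
      infer_instance
    simpa using add_le_add_left h0 (ys.length : WithBot ℕ∞)
  rw [projectiveDimension_le_iff] at hpd'
  exact HasProjectiveDimensionLT.subsingleton _ (ys.length + 1) i (by omega) _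

theorem exists_hasInjectiveDimensionLE_of_ringEquiv {S C : Type u} [CommRing S] [CommRing C]
    (e : S ≃+* C) (h : ∃ n : ℕ, HasInjectiveDimensionLE (ModuleCat.of S S) n) :
    ∃ n : ℕ, HasInjectiveDimensionLE (ModuleCat.of C C) n := by
  obtain ⟨n, hn⟩ := h
  let : RingHomInvPair (RingHomClass.toRingHom e) (RingHomClass.toRingHom e.symm) :=
    RingHomInvPair.of_ringEquiv e
  let : RingHomInvPair (RingHomClass.toRingHom e.symm) (RingHomClass.toRingHom e) :=
    RingHomInvPair.of_ringEquiv e.symm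
  let e' : S ≃ₛₗ[RingHomClass.toRingHom e] C :=
    { e.toAddEquiv with map_smul' := fun r x => map_mul e r x }
  exact ⟨n, (ModuleCat.hasInjectiveDimensionLE_iff_of_semiLinearEquiv e
    (M := ModuleCat.of S S) (N := ModuleCat.of C C) e' n).1 hn⟩

theorem exists_hasInjectiveDimensionLE_of_isWeaklyRegular {C : Type u} [CommRing C] (n : ℕ) :
    ∀ {S : Type u} [CommRing S] (rs : List S), rs.length = n → IsWeaklyRegular S rs →
      (∃ n : ℕ, HasInjectiveDimensionLE (ModuleCat.of S S) n) → ∀ f : S →+* C,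
      Function.Surjective f → RingHom.ker f = Ideal.ofList rs →
      ∃ n : ℕ, HasInjectiveDimensionLE (ModuleCat.of C C) n := by
  induction n with
  | zero =>
    intro S _ rs hrs _ hS f hf hker
    rw [List.length_eq_zero_iff.1 hrs, Ideal.ofList_nil] at hker
    exact exists_hasInjectiveDimensionLE_of_ringEquiv (RingEquiv.ofBijective f
      ⟨(RingHom.injective_iff_ker_eq_bot f).2 hker, hf⟩) hS
  | succ n ih =>
    intro S _ rs hrs hreg hS f hf hker
    obtain _ | ⟨x, rs⟩ := rs
    · simp at hrs
    obtain ⟨hx, hreg'⟩ := (isWeaklyRegular_cons_iff' _ _ _).1 hreg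
    obtain ⟨k, hk⟩ := hS
    -- The bound is weakened to k + 1 so that the step down to the quotient also applies when k = 0.
    have hk' : HasInjectiveDimensionLE (ModuleCat.of S S) (k + 1) :=
      hasInjectiveDimensionLT_of_ge _ (k + 1) _ (by omega)
    have hx0 : x ∈ nonZeroDivisors S := mem_nonZeroDivisors_iff_right.2 fun z hz =>
      hx (show x • z = x • 0 by rw [smul_eq_mul, smul_zero, mul_comm, hz])
    have hQ := hasInjectiveDimensionLE_quotSMulTop hx0 k S hx
    have hQ' : HasInjectiveDimensionLE
        (ModuleCat.of (S ⧸ Ideal.span {x}) (S ⧸ Ideal.span {x})) k :=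
      (ModuleCat.hasInjectiveDimensionLE_iff_of_linearEquiv (quotSMulTopEquivQuotient x) k).1 hQ
    have hle : Ideal.span {x} ≤ RingHom.ker f := by
      rw [hker, Ideal.ofList_cons]
      exact le_sup_left
    refine ih (rs.map (Ideal.Quotient.mk (Ideal.span {x}))) (by simpa using hrs)
      (((quotSMulTopEquivQuotient x).isWeaklyRegular_congr _).1 hreg') ⟨k, hQ'⟩
      (Ideal.Quotient.lift (Ideal.span {x}) f hle)
      (Ideal.Quotient.lift_surjective_of_surjective _ _ hf) ?_
    rw [Ideal.ker_quotient_lift, hker, Ideal.ofList_cons, Ideal.map_sup, Ideal.map_quotient_self,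
      bot_sup_eq, Ideal.map_ofList]

/-- Depth is measured by Ext from k: dividing by one regular element costs one degree of vanishing,
and the vanishing left after rs is used up produces the remaining elements. -/
theorem exists_isRegular_append {S : Type u} [CommRing S] [IsLocalRing S] [IsNoetherianRing S]
    (rs : List S) : ∀ (M : ModuleCat.{u} S) [Module.Finite S M] (n : ℕ),
      (∀ i < n, Subsingleton (Ext (ModuleCat.of S (ResidueField S)) M i)) →
      IsRegular M rs → rs.length ≤ n →
      ∃ zs : List S, zs.length + rs.length = n ∧ (∀ r ∈ zs, r ∈ maximalIdeal S) ∧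
        IsRegular M (rs ++ zs) := by
  induction rs with
  | nil =>
    intro M _ n h hreg _
    have := hreg.nontrivial
    have hsupp : Module.support S (ResidueField S) =
        PrimeSpectrum.zeroLocus (maximalIdeal S : Set S) := by
      have : Module.annihilator S (ResidueField S) = maximalIdeal S :=
        Ideal.annihilator_quotient
      rw [Module.support_eq_zeroLocus, this]
    obtain ⟨zs, hlen, hmem, hzs⟩ := ModuleCat.exists_isRegular_of_exists_subsingleton_ext
      (maximalIdeal S) n M (maximalIdeal_smul_top_lt M) (ModuleCat.of S (ResidueField S)) hsupp h
    exact ⟨zs, by simpa using hlen, hmem, hzs⟩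
  | cons a rs ih =>
    intro M _ n h hreg hn
    obtain ⟨m, rfl⟩ : ∃ m, n = m + 1 := ⟨n - 1, by rw [List.length_cons] at hn; omega⟩
    obtain ⟨ha, hreg'⟩ := (isRegular_cons_iff _ _ _).1 hreg
    have hS := ha.smulShortComplex_shortExact
    obtain ⟨zs, hlen, hmem, hzs⟩ := ih (ModuleCat.of S (QuotSMulTop a M)) m (fun i hi => by
      refine subsingleton_of_forall_eq 0 fun x => ?_
      obtain ⟨y, hy⟩ := Ext.covariant_sequence_exact₃ _ hS x rfl
        (@Subsingleton.elim _ (h (i + 1) (by omega)) _ _)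
      have hy0 : y = 0 := @Subsingleton.elim _ (h i (by omega)) y 0
      subst hy0
      exact hy.symm.trans (Ext.zero_comp _ _ _ _ _)) hreg' (by simpa using hn)
    refine ⟨zs, ?_, hmem, (isRegular_cons_iff _ _ _).2 ⟨ha, hzs⟩⟩
    rw [List.length_cons]
    omega

/-- The socle of `M` is isomorphic to the residue field. -/
def HasSimpleSocle (B : Type*) [CommRing B] [IsLocalRing B] (M : Type*) [AddCommGroup M]
    [Module B M] : Prop :=
  ∃ s : M, s ≠ 0 ∧ (∀ r ∈ maximalIdeal B, r • s = 0) ∧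
    ∀ n : M, (∀ r ∈ maximalIdeal B, r • n = 0) → ∃ b : B, n = b • s

theorem hasSimpleSocle_iff {B : Type u} [CommRing B] [IsLocalRing B] (M : Type v)
    [AddCommGroup M] [Module B M] :
    HasSimpleSocle B M ↔ Nonempty ((ResidueField B →ₗ[B] M) ≃ₗ[B] ResidueField B) := by
  have hsm : ∀ (r : B), r ∈ maximalIdeal B → ∀ y : ResidueField B, r • y = 0 := fun r hr y => by
    rw [Algebra.smul_def, show algebraMap B (ResidueField B) r = 0 from
      (residue_eq_zero_iff r).2 hr, zero_mul]
  constructor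
  · rintro ⟨s, hs0, hs, hall⟩
    let φ : B →ₗ[B] (ResidueField B →ₗ[B] M) :=
      { toFun := fun b => Submodule.liftQ (maximalIdeal B) (LinearMap.toSpanSingleton B M (b • s))
          fun r hr => by
            rw [LinearMap.mem_ker, LinearMap.toSpanSingleton_apply, smul_comm, hs r hr, smul_zero]
        map_add' := fun a b => Submodule.linearMap_qext _ <| LinearMap.ext fun y => by
          change y • (a + b) • s = y • a • s + y • b • s
          rw [add_smul, smul_add]
        map_smul' := fun a b => Submodule.linearMap_qext _ <| LinearMap.ext fun y => by
          change y • (a * b) • s = a • y • b • s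
          rw [mul_smul, smul_comm] }
    have hφ : ∀ b, φ b (1 : ResidueField B) = b • s := fun b => one_smul B _
    have hker : LinearMap.ker φ = maximalIdeal B := by
      ext b
      constructor
      · intro hb
        by_contra hu
        obtain ⟨u, rfl⟩ := not_not.1 ((mem_maximalIdeal b).not.1 hu)
        refine hs0 ?_
        have : (u : B) • s = 0 := by rw [← hφ, LinearMap.mem_ker.1 hb, LinearMap.zero_apply]
        simpa using congrArg (fun y => (↑u⁻¹ : B) • y) this
      · intro hb
        refine LinearMap.mem_ker.2 (LinearMap.ext fun y => ?_)
        obtain ⟨y, rfl⟩ := Ideal.Quotient.mk_surjective y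
        change y • b • s = 0
        rw [hs b hb, smul_zero]
    have hsurj : Function.Surjective φ := by
      intro g
      obtain ⟨b, hb⟩ := hall (g 1) fun r hr => by rw [← map_smul, hsm r hr, map_zero]
      refine ⟨b, LinearMap.ext fun y => ?_⟩
      obtain ⟨y, rfl⟩ := Ideal.Quotient.mk_surjective y
      have : Ideal.Quotient.mk (maximalIdeal B) y = y • (1 : ResidueField B) := by
        rw [Algebra.smul_def, mul_one]
        rfl
      rw [this, map_smul, map_smul, hφ, hb]
    exact ⟨((Submodule.quotEquivOfEq _ _ hker.symm).trans
      (φ.quotKerEquivOfSurjective hsurj)).symm⟩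
  · rintro ⟨e⟩
    let g := e.symm 1
    have hg : g ≠ 0 := by
      rw [Ne, LinearEquiv.map_eq_zero_iff]
      exact one_ne_zero
    have hg1 : ∀ g : ResidueField B →ₗ[B] M, g 1 = 0 → g = 0 := fun g h =>
      LinearMap.ext fun y => by
        obtain ⟨y, rfl⟩ := Ideal.Quotient.mk_surjective y
        have : Ideal.Quotient.mk (maximalIdeal B) y = y • (1 : ResidueField B) := by
          rw [Algebra.smul_def, mul_one]
          rfl
        rw [this, map_smul, h, smul_zero, LinearMap.zero_apply]
    refine ⟨g 1, fun h => hg (hg1 g h), fun r hr => by rw [← map_smul, hsm r hr, map_zero],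
      fun n hn => ?_⟩
    let h : ResidueField B →ₗ[B] M :=
      Submodule.liftQ (maximalIdeal B) (LinearMap.toSpanSingleton B M n) fun r hr => hn r hr
    obtain ⟨b, hb⟩ := Ideal.Quotient.mk_surjective (e h)
    refine ⟨b, ?_⟩
    have h1 : h = b • g := by
      apply e.injective
      rw [map_smul, e.apply_symm_apply, ← hb, Algebra.smul_def, mul_one]
      rfl
    have h2 : h 1 = n := one_smul B n
    rw [← h2, h1, LinearMap.smul_apply]

/-- The elementwise form of the socle condition, unlike one phrased with Ext, passes directly to
another base ring. -/
theorem HasSimpleSocle.of_surjective {B C : Type*} [CommRing B] [IsLocalRing B] [CommRing C]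
    [IsLocalRing C] {f : B →+* C} (hf : Function.Surjective f) {M N : Type*} [AddCommGroup M]
    [Module B M] [AddCommGroup N] [Module C N] (e : M ≃+ N)
    (he : ∀ (b : B) (m : M), e (b • m) = f b • e m) (h : HasSimpleSocle B M) :
    HasSimpleSocle C N := by
  have hloc := hf.isLocalHom
  have hmem : ∀ b, f b ∈ maximalIdeal C ↔ b ∈ maximalIdeal B := fun b => by
    rw [mem_maximalIdeal, mem_maximalIdeal, mem_nonunits_iff, mem_nonunits_iff, isUnit_map_iff]
  obtain ⟨s, hs0, hs, hall⟩ := h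
  refine ⟨e s, by simpa using hs0, fun c hc => ?_, fun n hn => ?_⟩
  · obtain ⟨b, rfl⟩ := hf c
    rw [← he, hs b ((hmem b).1 hc), map_zero]
  · obtain ⟨n, rfl⟩ := e.surjective n
    obtain ⟨b, hb⟩ := hall n fun r hr => e.injective (by rw [he, hn _ ((hmem r).2 hr), map_zero])
    exact ⟨f b, by rw [hb, he]⟩

theorem HasSimpleSocle.of_linearEquiv {B : Type*} [CommRing B] [IsLocalRing B] {M N : Type*}
    [AddCommGroup M] [Module B M] [AddCommGroup N] [Module B N] (e : M ≃ₗ[B] N)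
    (h : HasSimpleSocle B M) : HasSimpleSocle B N :=
  h.of_surjective (f := RingHom.id B) Function.surjective_id e.toAddEquiv fun b m => e.map_smul b m

theorem hasSimpleSocle_quotient_maximalIdeal (B : Type*) [CommRing B] [IsLocalRing B] :
    HasSimpleSocle B (B ⧸ maximalIdeal B) := by
  refine ⟨Submodule.Quotient.mk 1, ?_, fun r hr => ?_, fun y _ => ?_⟩
  · rw [Ne, Submodule.Quotient.mk_eq_zero]
    exact (Ideal.ne_top_iff_one _).1 (maximalIdeal.isMaximal B).ne_top
  · rw [← Submodule.Quotient.mk_smul, Submodule.Quotient.mk_eq_zero]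
    exact Ideal.mul_mem_right _ _ hr
  · obtain ⟨y, rfl⟩ := Submodule.Quotient.mk_surjective _ y
    exact ⟨y, by rw [← Submodule.Quotient.mk_smul, smul_eq_mul, mul_one]⟩

/-- The left side sees only the length of rs, so simplicity of the socle transfers between regular
sequences of equal length. -/
theorem ext_length_equiv_iff {B : Type u} [CommRing B] [IsLocalRing B] [IsNoetherianRing B]
    (M : ModuleCat.{u} B) [Module.Finite B M] (rs : List B)
    (hmem : ∀ r ∈ rs, r ∈ maximalIdeal B) (hreg : IsRegular M rs) :
    Nonempty (Ext (ModuleCat.of B (ResidueField B)) M rs.length ≃ₗ[B] ResidueField B) ↔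
      HasSimpleSocle B (M ⧸ (Ideal.ofList rs • ⊤ : Submodule B M)) := by
  obtain ⟨e⟩ := nonempty_ext_length_equiv M rs hmem hreg
  rw [hasSimpleSocle_iff]
  exact ⟨fun ⟨e'⟩ => ⟨e.symm.trans e'⟩, fun ⟨e'⟩ => ⟨e.trans e'⟩⟩

/-- A quotient of a regular local ring by a regular sequence is Cohen–Macaulay of type `1`. -/
theorem exists_isRegular_and_hasSimpleSocle {S C : Type u} [CommRing S] [IsRegularLocalRing S]
    [CommRing C] [IsLocalRing C] [IsNoetherianRing C] (rs : List S) (hrs : IsRegular S rs)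
    (f : S →+* C) (hf : Function.Surjective f) (hker : RingHom.ker f = Ideal.ofList rs) :
    ∃ zs : List C, (∀ r ∈ zs, r ∈ maximalIdeal C) ∧ IsRegular C zs ∧
      (zs.length : WithBot ℕ∞) = ringKrullDim C ∧
      HasSimpleSocle C (C ⧸ (Ideal.ofList zs • ⊤ : Submodule C C)) := by
  obtain ⟨n, hn⟩ : ∃ n : ℕ, ringKrullDim S = n := by
    have := (isRegularLocalRing_iff S).1 inferInstance
    exact ⟨_, this.symm⟩
  have hloc := hf.isLocalHom
  obtain ⟨-, ys, hys, hysm⟩ := IsRegularLocalRing.isDomain_and_exists_isRegular n S hn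
  have hysmem : ∀ r ∈ ys, r ∈ maximalIdeal S := fun r hr => hysm ▸ Ideal.subset_span hr
  have hyslen : ys.length = n := by
    have h1 := ringKrullDim_add_length_eq_ringKrullDim_of_isRegular ys hys
    rw [hysm, hn] at h1
    have h2 : ringKrullDim (S ⧸ maximalIdeal S) = 0 :=
      ringKrullDim_eq_zero_of_isField ((Ideal.Quotient.maximal_ideal_iff_isField_quotient _).1
        inferInstance)
    rw [h2, zero_add] at h1
    exact_mod_cast h1
  have hdim : ringKrullDim C + rs.length = n := by
    rw [← hn, ← ringKrullDim_add_length_eq_ringKrullDim_of_isRegular rs hrs, ← hker,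
      ringKrullDim_eq_of_ringEquiv (RingHom.quotientKerEquivOfSurjective hf)]
  have hlen : rs.length ≤ n := by
    have h0 := ringKrullDim_nonneg_of_nontrivial (R := C)
    have h1 : (0 : WithBot ℕ∞) + rs.length ≤ ringKrullDim C + rs.length := add_le_add_left h0 _
    rw [hdim, zero_add] at h1
    exact_mod_cast h1
  obtain ⟨zs, hzlen, hzmem, hz⟩ := exists_isRegular_append rs (ModuleCat.of S S) n
    (hyslen ▸ subsingleton_ext_residueField_of_isRegular (ModuleCat.of S S) ys hysmem hys) hrs hlen
  have hrsmem : ∀ r ∈ rs, r ∈ maximalIdeal S := fun r hr => by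
    have hne : Ideal.ofList rs ≠ ⊤ := fun h => hrs.2 (by rw [h, Submodule.top_smul])
    exact le_maximalIdeal hne (Ideal.subset_span hr)
  -- For the sequence ys generating 𝔪 the quotient is k, whose socle is simple; rs ++ zs has the
  -- same length.
  have hsoc : HasSimpleSocle S (S ⧸ (Ideal.ofList (rs ++ zs) • ⊤ : Submodule S S)) := by
    refine (ext_length_equiv_iff (ModuleCat.of S S) (rs ++ zs) (fun r hr =>
      (List.mem_append.1 hr).elim (hrsmem r) (hzmem r)) hz).1 ?_
    rw [List.length_append, add_comm, hzlen, ← hyslen]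
    refine (ext_length_equiv_iff (ModuleCat.of S S) ys hysmem hys).2 ?_
    have he : (maximalIdeal S : Submodule S S) =
        (Ideal.ofList ys • ⊤ : Submodule S (ModuleCat.of S S)) := by
      rw [hysm]
      exact (Ideal.mul_top _).symm
    exact (hasSimpleSocle_quotient_maximalIdeal S).of_linearEquiv (Submodule.quotEquivOfEq _ _ he)
  have hmem' : ∀ r ∈ zs.map f, r ∈ maximalIdeal C := fun r hr => by
    obtain ⟨r, hr', rfl⟩ := List.mem_map.1 hr
    exact (mem_maximalIdeal _).2 fun h => hzmem r hr' (isUnit_of_map_unit f r h)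
  let J : Ideal C := Ideal.ofList (zs.map f)
  have hJtop : (J • ⊤ : Submodule C C) = J := Ideal.mul_top _
  have hcomap : ∀ ws : List S, RingHom.ker ((Ideal.Quotient.mk (Ideal.ofList (ws.map f))).comp f) =
      Ideal.ofList (rs ++ ws) := fun ws => by
    rw [← RingHom.comap_ker, Ideal.mk_ker, ← Ideal.map_ofList, Ideal.comap_map_of_surjective _ hf,
      ← RingHom.ker_eq_comap_bot, hker, Ideal.ofList_append, sup_comm]
  refine ⟨zs.map f, hmem', ?_, ?_, ?_⟩
  · refine (IsLocalRing.isRegular_iff_isWeaklyRegular_of_subset_maximalIdeal hmem').2 ?_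
    have h1 := ((isWeaklyRegular_append_iff S rs zs).1 hz.1).2
    have h2 : (Ideal.ofList rs • ⊤ : Submodule S S) = RingHom.ker f := by
      rw [hker]
      exact Ideal.mul_top _
    let e : (S ⧸ (Ideal.ofList rs • ⊤ : Submodule S S)) ≃+ C :=
      (Submodule.quotEquivOfEq _ _ h2).toAddEquiv.trans
        (RingHom.quotientKerEquivOfSurjective hf).toAddEquiv
    refine (AddEquiv.isWeaklyRegular_congr (e := e) ?_).1 h1
    refine List.forall₂_map_right_iff.2 (List.forall₂_same.2 fun r _ y => ?_)
    obtain ⟨y, rfl⟩ := Submodule.Quotient.mk_surjective _ y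
    exact map_mul f r y
  · have : ((zs.length : WithBot ℕ∞)) + rs.length = ringKrullDim C + rs.length := by
      rw [hdim]
      exact_mod_cast hzlen
    rw [List.length_map]
    exact le_antisymm (ENat.WithBot.add_le_add_natCast_right_iff.1 this.le)
      (ENat.WithBot.add_le_add_natCast_right_iff.1 this.ge)
  · have h2 : (Ideal.ofList (rs ++ zs) • ⊤ : Submodule S S) =
        RingHom.ker ((Ideal.Quotient.mk J).comp f) := by
      rw [hcomap zs]
      exact Ideal.mul_top _
    have h3 : HasSimpleSocle S (S ⧸ RingHom.ker ((Ideal.Quotient.mk J).comp f)) :=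
      hsoc.of_linearEquiv (Submodule.quotEquivOfEq _ _ h2)
    have h4 : HasSimpleSocle C (C ⧸ J) := by
      refine h3.of_surjective hf (RingHom.quotientKerEquivOfSurjective
          (f := (Ideal.Quotient.mk J).comp f)
          (Ideal.Quotient.mk_surjective.comp hf)).toAddEquiv fun b m => ?_
      obtain ⟨m, rfl⟩ := Ideal.Quotient.mk_surjective m
      exact map_mul ((Ideal.Quotient.mk J).comp f) b m
    exact h4.of_linearEquiv (Submodule.quotEquivOfEq _ _ hJtop.symm)

theorem isGorensteinLocalRing_of_isLocalCompleteIntersectionRing {B : Type u} [CommRing B]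
    [IsLocalRing B] [IsAdicComplete (maximalIdeal B) B]
    (h : IsLocalCompleteIntersectionRing B) : IsGorensteinLocalRing B := by
  obtain ⟨_, hnoeth, S, _, _, rs, hrs, ⟨e⟩⟩ := h
  let e' : S ⧸ Ideal.ofList rs ≃+* B :=
    (e.symm.trans (AdicCompletion.ofAlgEquiv (maximalIdeal B)).symm.toRingEquiv)
  let f : S →+* B := e'.toRingHom.comp (Ideal.Quotient.mk _)
  have hf : Function.Surjective f := e'.surjective.comp Ideal.Quotient.mk_surjective
  have hker : RingHom.ker f = Ideal.ofList rs := by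
    ext x
    rw [RingHom.mem_ker, ← Ideal.Quotient.eq_zero_iff_mem]
    exact e'.map_eq_zero_iff
  obtain ⟨zs, hmem, hreg, hlen, hsoc⟩ := exists_isRegular_and_hasSimpleSocle rs hrs f hf hker
  have hCM : IsMaximalCohenMacaulay B B := ⟨inferInstance, zs, hmem, hreg, hlen⟩
  refine ⟨inferInstance, hnoeth, B, inferInstance, inferInstance, ⟨hCM, hCM, fun d hd => ?_, ?_⟩,
    inferInstance, Module.finrank_self B⟩
  · obtain rfl : d = zs.length := by
      rw [← hlen] at hd
      exact_mod_cast hd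
    exact (ext_length_equiv_iff (ModuleCat.of B B) zs hmem hreg).2 hsoc
  · exact exists_hasInjectiveDimensionLE_of_isWeaklyRegular _ rs rfl hrs.1
      (exists_hasInjectiveDimensionLE_of_regularLocal S) f hf hker

end Gorenstein

/-! ### Finite local algebras over complete local rings -/

section Complete

theorem exists_maximalIdeal_pow_le_map (A : Type u) (B : Type v) [CommRing A] [CommRing B]
    [IsLocalRing A] [IsLocalRing B] [Algebra A B] [Module.Finite A B] :
    ∃ n : ℕ, maximalIdeal B ^ n ≤ (maximalIdeal A).map (algebraMap A B) := by
  let : Field (A ⧸ maximalIdeal A) := Ideal.Quotient.field _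
  have : Module.Finite (A ⧸ maximalIdeal A) (B ⧸ (maximalIdeal A).map (algebraMap A B)) :=
    Module.Finite.of_restrictScalars_finite A _ _
  have : IsArtinianRing (B ⧸ (maximalIdeal A).map (algebraMap A B)) :=
    IsArtinianRing.of_finite (A ⧸ maximalIdeal A) _
  exact exists_maximalIdeal_pow_le_of_isArtinianRing_quotient _

theorem map_maximalIdeal_le_of_finite (A : Type u) (B : Type v) [CommRing A] [CommRing B]
    [IsLocalRing A] [IsLocalRing B] [Algebra A B] [Module.Finite A B] :
    (maximalIdeal A).map (algebraMap A B) ≤ maximalIdeal B := by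
  rw [Ideal.map_le_iff_le_comap]
  have : ((maximalIdeal B).comap (algebraMap A B)).IsMaximal :=
    Ideal.isMaximal_comap_of_isIntegral_of_isMaximal _
  rw [IsLocalRing.eq_maximalIdeal this]

theorem isPrecomplete_of_finite {A : Type*} [CommRing A] (I : Ideal A) [IsPrecomplete I A] (M : Type*) [AddCommGroup M]
    [Module A M] [Module.Finite A M] : IsPrecomplete I M := by
  rw [← AdicCompletion.of_surjective_iff]
  intro y
  obtain ⟨z, rfl⟩ := AdicCompletion.ofTensorProduct_surjective_of_finite I M y
  induction z with
  | zero => exact ⟨0, by simp⟩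
  | tmul r x =>
    obtain ⟨a, rfl⟩ := AdicCompletion.of_surjective I A r
    refine ⟨a • x, ?_⟩
    rw [AdicCompletion.ofTensorProduct_tmul, map_smul]
    ext n
    rfl
  | add y z hy hz =>
    obtain ⟨a, ha⟩ := hy
    obtain ⟨b, hb⟩ := hz
    exact ⟨a + b, by rw [map_add, map_add, ha, hb]⟩

theorem isAdicComplete_maximalIdeal_of_finite (A : Type u) (B : Type v) [CommRing A] [CommRing B]
    [IsLocalRing A] [IsLocalRing B] [Algebra A B] [Module.Finite A B] [IsNoetherianRing A]
    [IsAdicComplete (maximalIdeal A) A] : IsAdicComplete (maximalIdeal B) B := by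
  have : IsNoetherianRing B := IsNoetherianRing.of_finite A B
  obtain ⟨k, hk⟩ := exists_maximalIdeal_pow_le_map A B
  set J := (maximalIdeal A).map (algebraMap A B) with hJ
  have hJm : J ≤ maximalIdeal B := map_maximalIdeal_le_of_finite A B
  have hJc : IsPrecomplete J B :=
    IsPrecomplete.map_algebraMap_iff.2 (isPrecomplete_of_finite (maximalIdeal A) B)
  have hk' : maximalIdeal B ^ (k + 1) ≤ J := (Ideal.pow_le_pow_right k.le_succ).trans hk
  have : IsPrecomplete (maximalIdeal B) B := by
    refine ⟨fun f hf => ?_⟩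
    -- Since 𝔪_B^(k+1) ≤ J, sampling f at multiples of k + 1 gives a J-Cauchy sequence; its J-adic
    -- limit is also an 𝔪_B-adic limit because J ≤ 𝔪_B. Using k + 1 instead of k ensures n ≤ n(k +
    -- 1).
    obtain ⟨L, hL⟩ := hJc.prec (f := fun n => f (n * (k + 1))) fun {m n} hmn => by
      refine (hf (Nat.mul_le_mul_right (k + 1) hmn)).mono (Submodule.smul_mono_left ?_)
      rw [mul_comm, pow_mul]
      exact Ideal.pow_right_mono hk' m
    refine ⟨L, fun n => ?_⟩
    refine (hf (Nat.le_mul_of_pos_right n k.succ_pos)).trans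
      ((hL n).mono (Submodule.smul_mono_left (Ideal.pow_right_mono hJm n)))
  exact {}

/-- A complete local ring that is a quotient of a regular local ring by a regular sequence is a
complete intersection. -/
theorem isLocalCompleteIntersectionRing_of_surjective {B : Type u} [CommRing B] [IsLocalRing B]
    [IsNoetherianRing B] [IsAdicComplete (maximalIdeal B) B] {S : Type u} [CommRing S]
    [IsRegularLocalRing S] {rs : List S} (hrs : RingTheory.Sequence.IsRegular S rs)
    (f : S →+* B) (hf : Function.Surjective f) (hker : RingHom.ker f = Ideal.ofList rs) :
    IsLocalCompleteIntersectionRing B :=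
  ⟨inferInstance, inferInstance, S, inferInstance, inferInstance, rs, hrs,
    ⟨(AdicCompletion.ofAlgEquiv (maximalIdeal B)).symm.toRingEquiv.trans
      ((RingHom.quotientKerEquivOfSurjective hf).symm.trans (Ideal.quotEquivOfEq hker))⟩⟩

theorem IsLocalCompleteIntersectionRing.exists_surjective {B : Type u} [CommRing B]
    [IsLocalRing B] [IsAdicComplete (maximalIdeal B) B] (h : IsLocalCompleteIntersectionRing B) :
    ∃ (S : Type u) (_ : CommRing S) (_ : IsRegularLocalRing S) (rs : List S) (f : S →+* B),
      RingTheory.Sequence.IsRegular S rs ∧ Function.Surjective f ∧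
        RingHom.ker f = Ideal.ofList rs := by
  obtain ⟨_, _, S, _, _, rs, hrs, ⟨e⟩⟩ := h
  let e' := (AdicCompletion.ofAlgEquiv (maximalIdeal B)).toRingEquiv.trans e
  refine ⟨S, inferInstance, inferInstance, rs,
    (e'.symm : S ⧸ Ideal.ofList rs →+* B).comp (Ideal.Quotient.mk _), hrs,
    e'.symm.surjective.comp Ideal.Quotient.mk_surjective, ?_⟩
  rw [← RingHom.comap_ker]
  simp [← RingHom.ker_eq_comap_bot]

end Complete

/-! ### Algebras generated by one element -/

section Monogenic

open Polynomial RingTheory.Sequence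

/-- Iterating the decomposition gives B = A[t] + tⁿB for all n. For large n, tⁿ lies in 𝔪_A B, and
Nakayama concludes. -/
theorem adjoin_singleton_eq_top_of_exists_add_mul {A : Type u} {B : Type v} [CommRing A]
    [CommRing B] [IsLocalRing A] [IsLocalRing B] [Algebra A B] [Module.Finite A B] {t : B} (ht : t ∈ maximalIdeal B)
    (h : ∀ b : B, ∃ (a : A) (c : B), b = algebraMap A B a + t * c) :
    Algebra.adjoin A {t} = ⊤ := by
  obtain ⟨n, hn⟩ := exists_maximalIdeal_pow_le_map A B
  have key : ∀ (j : ℕ) (b : B), ∃ a ∈ Algebra.adjoin A {t}, ∃ c : B, b = a + t ^ j * c := by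
    intro j
    induction j with
    | zero => exact fun b => ⟨0, zero_mem _, b, by simp⟩
    | succ j ih =>
      intro b
      obtain ⟨a, ha, c, rfl⟩ := ih b
      obtain ⟨a', c', rfl⟩ := h c
      refine ⟨a + t ^ j * algebraMap A B a', add_mem ha (mul_mem (pow_mem
        (Algebra.self_mem_adjoin_singleton A t) j) (Subalgebra.algebraMap_mem _ a')), c', ?_⟩
      ring
  have hle : (⊤ : Submodule A B) ≤ Subalgebra.toSubmodule (Algebra.adjoin A {t}) := by
    refine Submodule.le_of_le_smul_of_le_jacobson_bot (I := maximalIdeal A) Module.Finite.fg_top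
      (IsLocalRing.maximalIdeal_le_jacobson _) fun b _ => ?_
    obtain ⟨a, ha, c, rfl⟩ := key n b
    refine Submodule.add_mem_sup ((Subalgebra.mem_toSubmodule _).2 ha) ?_
    rw [Ideal.smul_top_eq_map]
    exact Submodule.restrictScalars_mem A _ _ |>.2
      (Ideal.mul_mem_right _ _ (hn (Ideal.pow_mem_pow ht n)))
  exact top_le_iff.1 fun b _ => hle trivial

/-- Cayley–Hamilton gives a surjection A[X]/(f) → B of free modules of equal finite rank, which is
therefore injective. -/
theorem ker_aeval_eq_span_charpoly {A : Type u} {B : Type v} [CommRing A] [CommRing B]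
    [IsLocalRing A] [Algebra A B] [Module.Finite A B] [Module.Free A B] {t : B} (ht : Algebra.adjoin A {t} = ⊤) :
    RingHom.ker (aeval (R := A) t) = Ideal.span {(LinearMap.mulLeft A t).charpoly} := by
  set f := (LinearMap.mulLeft A t).charpoly with hf
  have hmon : f.Monic := LinearMap.charpoly_monic _
  have hroot : aeval t f = 0 := by
    have h1 := LinearMap.congr_fun (LinearMap.aeval_self_charpoly (LinearMap.mulLeft A t)) 1
    have h2 : aeval (Algebra.lmul A B t) f = Algebra.lmul A B (aeval t f) :=
      aeval_algHom_apply (Algebra.lmul A B) t f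
    have h3 : aeval (LinearMap.mulLeft A t) f = Algebra.lmul A B (aeval t f) := h2
    rw [← hf, h3] at h1
    simpa using h1
  have := hmon.finite_adjoinRoot
  have := hmon.free_adjoinRoot
  let φ : AdjoinRoot f →ₐ[A] B := AdjoinRoot.liftAlgHom f (Algebra.ofId A B) t hroot
  have hφ : ∀ g : A[X], φ (AdjoinRoot.mk f g) = aeval t g := fun g => by
    simp [φ, aeval_def, Algebra.ofId]
  have hsurj : Function.Surjective φ := by
    intro b
    have hb : b ∈ Algebra.adjoin A {t} := ht ▸ trivial
    rw [Algebra.adjoin_singleton_eq_range_aeval] at hb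
    obtain ⟨g, rfl⟩ := hb
    exact ⟨AdjoinRoot.mk f g, hφ g⟩
  have hrank : Module.finrank A (AdjoinRoot f) = Module.finrank A B := by
    rw [(AdjoinRoot.powerBasis' hmon).finrank, AdjoinRoot.powerBasis'_dim,
      LinearMap.charpoly_natDegree]
  have hinj : Function.Injective φ := by
    let e := LinearEquiv.ofFinrankEq B (AdjoinRoot f) hrank.symm
    have := OrzechProperty.injective_of_surjective_endomorphism (e.toLinearMap ∘ₗ φ.toLinearMap)
      (e.surjective.comp hsurj)
    exact fun x y hxy => this (congrArg e hxy)
  ext g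
  rw [RingHom.mem_ker, Ideal.mem_span_singleton, ← AdjoinRoot.mk_eq_zero, ← hφ,
    map_eq_zero_iff φ hinj]

end Monogenic

/-! ### Monogenic algebras over complete intersections -/

section MonogenicCI

open Polynomial RingTheory.Sequence

/-- A lift to `S[X]` of a monic polynomial over `S / (rs)` is a nonzerodivisor modulo `rs`. -/
theorem isWeaklyRegular_map_C_append_singleton {S A : Type*} [CommRing S] [CommRing A]
    (q : S →+* A) {rs : List S} (hrs : IsWeaklyRegular S rs)
    (hker : RingHom.ker q = Ideal.ofList rs) {F : S[X]} (hF : (F.map q).Monic) :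
    IsWeaklyRegular S[X] (rs.map C ++ [F]) := by
  have hker' : RingHom.ker (mapRingHom q) = Ideal.ofList (rs.map C) := by
    rw [Polynomial.ker_mapRingHom, hker, Ideal.map_ofList]
  rw [isWeaklyRegular_append_iff]
  refine ⟨by simpa using hrs.of_flat (S := S[X]), ?_⟩
  rw [isWeaklyRegular_singleton_iff, isSMulRegular_iff_right_eq_zero_of_smul]
  intro x hx
  obtain ⟨g, rfl⟩ := Submodule.Quotient.mk_surjective _ x
  rw [← Submodule.Quotient.mk_smul, Submodule.Quotient.mk_eq_zero, smul_eq_mul, Ideal.mul_top,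
    smul_eq_mul, ← hker', RingHom.mem_ker, map_mul] at hx
  rw [Submodule.Quotient.mk_eq_zero, smul_eq_mul, Ideal.mul_top, ← hker', RingHom.mem_ker]
  exact (hF.mul_right_eq_zero_iff).1 hx

/-- The kernel of the extension of a ring homomorphism to a localization. -/
theorem ker_lift_localization_atPrime {P B : Type*} [CommRing P] [CommRing B] [IsLocalRing B]
    (g : P →+* B) (𝔭 : Ideal P) [𝔭.IsPrime] (h𝔭 : ∀ y : 𝔭.primeCompl, IsUnit (g y)) :
    RingHom.ker (IsLocalization.lift (S := Localization.AtPrime 𝔭) h𝔭) =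
      (RingHom.ker g).map (algebraMap P (Localization.AtPrime 𝔭)) := by
  ext z
  obtain ⟨x, s, rfl⟩ := IsLocalization.exists_mk'_eq 𝔭.primeCompl z
  rw [RingHom.mem_ker, IsLocalization.lift_mk', Units.mul_left_eq_zero]
  constructor
  · intro hx
    rw [IsLocalization.mk'_eq_mul_mk'_one]
    exact Ideal.mul_mem_right _ _ (Ideal.mem_map_of_mem _ hx)
  · intro hx
    have h := Ideal.mul_mem_right (algebraMap P (Localization.AtPrime 𝔭) s) _ hx
    rw [IsLocalization.mk'_spec] at h
    have h2 : (RingHom.ker g).map (algebraMap P (Localization.AtPrime 𝔭)) ≤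
        RingHom.ker (IsLocalization.lift (S := Localization.AtPrime 𝔭) h𝔭) := by
      rw [Ideal.map_le_iff_le_comap]
      intro y hy
      simpa [RingHom.mem_ker] using hy
    simpa [RingHom.mem_ker] using h2 h

/-- With A = S/(rs) and B = A[X]/(f), B is S[X]/(rs, F) for a lift F of f. Localizing S[X] at the
preimage of 𝔪_B, which lies over 𝔪_S, gives a regular local ring and leaves the quotient B
unchanged, as B is already local. -/
theorem isLocalCompleteIntersectionRing_of_adjoin_singleton {A B : Type u} [CommRing A]
    [CommRing B] [IsLocalRing A] [IsNoetherianRing A] [IsAdicComplete (maximalIdeal A) A]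
    [IsLocalRing B] [Algebra A B] [Module.Finite A B] [Module.Free A B]
    (hA : IsLocalCompleteIntersectionRing A) {t : B} (ht : Algebra.adjoin A {t} = ⊤) :
    IsLocalCompleteIntersectionRing B := by
  have : IsNoetherianRing B := IsNoetherianRing.of_finite A B
  have := isAdicComplete_maximalIdeal_of_finite A B
  obtain ⟨S, _, _, rs, q, hrs, hq, hker⟩ := hA.exists_surjective
  set f := (LinearMap.mulLeft A t).charpoly with hf
  obtain ⟨F, hF⟩ := map_surjective q hq f
  have hFm : (F.map q).Monic := hF ▸ LinearMap.charpoly_monic _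
  let g : S[X] →+* B := ((aeval (R := A) t : A[X] →ₐ[A] B) : A[X] →+* B).comp (mapRingHom q)
  have hg : Function.Surjective g := by
    refine Function.Surjective.comp (g := aeval (R := A) t) ?_ (map_surjective q hq)
    intro b
    have hb : b ∈ Algebra.adjoin A {t} := ht ▸ trivial
    rw [Algebra.adjoin_singleton_eq_range_aeval] at hb
    exact hb
  have hgker : RingHom.ker g = Ideal.ofList (rs.map C ++ [F]) := by
    rw [Ideal.ofList_append, Ideal.ofList_singleton, ← Ideal.map_ofList, ← hker,
      ← Polynomial.ker_mapRingHom, ← RingHom.comap_ker]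
    have := ker_aeval_eq_span_charpoly ht
    change Ideal.comap _ (RingHom.ker (aeval (R := A) t)) = _
    rw [this, ← hf, ← hF, ← coe_mapRingHom, ← Set.image_singleton, ← Ideal.map_span,
      Ideal.comap_map_of_surjective' _ (map_surjective q hq), sup_comm]
  let 𝔭 : Ideal S[X] := (maximalIdeal B).comap g
  have hcomap : 𝔭.comap C = maximalIdeal S := by
    have h1 : 𝔭.comap C = (maximalIdeal A).comap q := by
      have : IsLocalHom (algebraMap A B) := ((local_hom_TFAE (algebraMap A B)).out 0 2).2
        (map_maximalIdeal_le_of_finite A B)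
      rw [← maximalIdeal_comap (algebraMap A B), Ideal.comap_comap, Ideal.comap_comap]
      congr 1
      ext s
      simp [g]
    have : IsLocalHom q := IsLocalHom.of_surjective q hq
    rw [h1, maximalIdeal_comap]
  have hreg := isRegularLocalRing_localization_atPrime_of_comap_eq_maximalIdeal S 𝔭 hcomap
  have h𝔭 : ∀ y : 𝔭.primeCompl, IsUnit (g y) := fun y => by
    by_contra h
    exact y.2 ((IsLocalRing.mem_maximalIdeal _).2 h)
  refine isLocalCompleteIntersectionRing_of_surjective (S := Localization.AtPrime 𝔭)
    ((isWeaklyRegular_map_C_append_singleton q hrs.toIsWeaklyRegular hker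
      hFm).isRegular_of_isLocalization_of_mem (Localization.AtPrime 𝔭) 𝔭 fun r hr => ?_)
    (IsLocalization.lift h𝔭) ?_ ?_
  · have : r ∈ RingHom.ker g := hgker ▸ Ideal.subset_span hr
    rw [Ideal.mem_comap, RingHom.mem_ker.1 this]
    exact zero_mem _
  · intro b
    obtain ⟨x, rfl⟩ := hg b
    exact ⟨algebraMap _ _ x, IsLocalization.lift_eq _ _⟩
  · rw [ker_lift_localization_atPrime, hgker, Ideal.map_ofList]

theorem isLocalCompleteIntersectionRing_of_exists_add_mul {A B : Type u} [CommRing A]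
    [CommRing B] [IsLocalRing A] [IsNoetherianRing A] [IsAdicComplete (maximalIdeal A) A]
    [IsLocalRing B] [Algebra A B] [Module.Finite A B] [Module.Free A B]
    (hA : IsLocalCompleteIntersectionRing A) {t : B} (ht : t ∈ maximalIdeal B)
    (h : ∀ b : B, ∃ (a : A) (c : B), b = algebraMap A B a + t * c) :
    IsLocalCompleteIntersectionRing B :=
  isLocalCompleteIntersectionRing_of_adjoin_singleton hA
    (adjoin_singleton_eq_top_of_exists_add_mul ht h)

end MonogenicCI

/-! ### Self-duality of finite free Gorenstein algebras -/

section Frobenius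

open RingTheory.Sequence Abelian

theorem apply_mem_of_mem_map_algebraMap {A B : Type*} [CommRing A] [CommRing B] [Algebra A B]
    (ℓ : B →ₗ[A] A) {J : Ideal A} {x : B} (hx : x ∈ J.map (algebraMap A B)) : ℓ x ∈ J := by
  have h : x ∈ (J • ⊤ : Submodule A B) := by
    rw [Ideal.smul_top_eq_map]
    exact hx
  refine Submodule.smul_induction_on h (fun r hr n _ => ?_) fun x y hx hy => ?_
  · rw [map_smul]
    exact J.mul_mem_right _ hr
  · rw [map_add]
    exact add_mem hx hy

theorem mem_map_algebraMap_iff_repr {ι A B : Type*} [Fintype ι] [CommRing A] [CommRing B]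
    [Algebra A B] (b : Module.Basis ι A B) {J : Ideal A} {x : B} :
    x ∈ J.map (algebraMap A B) ↔ ∀ i, b.repr x i ∈ J := by
  refine ⟨fun hx i => apply_mem_of_mem_map_algebraMap (b.coord i) hx, fun h => ?_⟩
  rw [← b.sum_repr x]
  refine Ideal.sum_mem _ fun i _ => ?_
  rw [Algebra.smul_def]
  exact Ideal.mul_mem_right _ _ (Ideal.mem_map_of_mem _ (h i))

/-- A nonzero element of the closed fibre of a finite local algebra has a nonzero multiple in the
socle. -/
theorem exists_mul_notMem_of_notMem {A B : Type*} [CommRing A] [CommRing B] [IsLocalRing A]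
    [IsLocalRing B] [Algebra A B] [Module.Finite A B] {b : B}
    (hb : b ∉ (maximalIdeal A).map (algebraMap A B)) :
    ∃ c, c * b ∉ (maximalIdeal A).map (algebraMap A B) ∧
      ∀ r ∈ maximalIdeal B, r * (c * b) ∈ (maximalIdeal A).map (algebraMap A B) := by
  set J := (maximalIdeal A).map (algebraMap A B)
  obtain ⟨n, hn⟩ := exists_maximalIdeal_pow_le_map A B
  have hex : ∃ j, ∀ c ∈ maximalIdeal B ^ j, c * b ∈ J :=
    ⟨n, fun c hc => J.mul_mem_right _ (hn hc)⟩
  classical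
  obtain ⟨j, hj⟩ : ∃ j, Nat.find hex = j + 1 := by
    refine Nat.exists_eq_succ_of_ne_zero fun h => hb ?_
    simpa using Nat.find_spec hex 1 (by simp [h])
  have h1 := Nat.find_min hex (m := j) (by omega)
  push Not at h1
  obtain ⟨c, hc, hcb⟩ := h1
  refine ⟨c, hcb, fun r hr => ?_⟩
  rw [← mul_assoc]
  refine Nat.find_spec hex _ ?_
  rw [hj, pow_succ']
  exact Ideal.mul_mem_mul hr hc

/-- The quotient A/(ys) has dimension 0, hence is Artinian; so is its finite algebra B/(ys)B, and
the length accounts for all of dim B. -/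
theorem map_algebraMap_length_eq_ringKrullDim {A B : Type u} [CommRing A] [CommRing B]
    [IsLocalRing A] [IsLocalRing B] [IsNoetherianRing A] [IsNoetherianRing B] [Algebra A B]
    [Module.Finite A B] {ys : List A} (hreg : IsRegular A ys)
    (hlen : (ys.length : WithBot ℕ∞) = ringKrullDim A)
    (hreg' : IsRegular B (ys.map (algebraMap A B))) :
    ((ys.map (algebraMap A B)).length : WithBot ℕ∞) = ringKrullDim B := by
  have h1 := ringKrullDim_add_length_eq_ringKrullDim_of_isRegular ys hreg
  rw [← hlen] at h1
  have h2 : ringKrullDim (A ⧸ Ideal.ofList ys) = 0 := by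
    refine (ENat.WithBot.add_le_add_natCast_right_iff (c := ys.length)).1
      (by rw [h1, zero_add]) |>.antisymm
      ((ENat.WithBot.add_le_add_natCast_right_iff (c := ys.length)).1 (by rw [h1, zero_add]))
  have hnt : Nontrivial (A ⧸ Ideal.ofList ys) := by
    rw [← not_subsingleton_iff_nontrivial]
    intro h
    simp [ringKrullDim_eq_bot_of_subsingleton] at h2
  have : IsArtinianRing (A ⧸ Ideal.ofList ys) := by
    rw [isArtinianRing_iff_krullDimLE_zero]
    exact Ring.krullDimLE_iff.2 h2.le
  have hnt' : Nontrivial (B ⧸ (Ideal.ofList ys).map (algebraMap A B)) := by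
    rw [Ideal.Quotient.nontrivial_iff, Ideal.map_ofList]
    intro h
    exact hreg'.2 (by simp [h])
  have : Module.Finite (A ⧸ Ideal.ofList ys) (B ⧸ (Ideal.ofList ys).map (algebraMap A B)) :=
    Module.Finite.of_restrictScalars_finite A _ _
  have : IsArtinianRing (B ⧸ (Ideal.ofList ys).map (algebraMap A B)) :=
    IsArtinianRing.of_finite (A ⧸ Ideal.ofList ys) _
  have h3 : ringKrullDim (B ⧸ Ideal.ofList (ys.map (algebraMap A B))) = 0 := by
    rw [← Ideal.map_ofList]
    exact ringKrullDimZero_iff_ringKrullDim_eq_zero.1 inferInstance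
  have h4 := ringKrullDim_add_length_eq_ringKrullDim_of_isRegular _ hreg'
  rwa [h3, zero_add] at h4

theorem IsGorensteinLocalRing.hasSimpleSocle {B : Type u} [CommRing B] [IsLocalRing B]
    (hB : IsGorensteinLocalRing B) {zs : List B} (hmem : ∀ r ∈ zs, r ∈ maximalIdeal B)
    (hreg : IsRegular B zs) (hlen : (zs.length : WithBot ℕ∞) = ringKrullDim B) :
    HasSimpleSocle B (B ⧸ Ideal.ofList zs) := by
  obtain ⟨_, _, M, _, _, hM, _, hrank⟩ := hB
  have := hM.maximalCohenMacaulay.1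
  let e : M ≃ₗ[B] B := LinearEquiv.ofFinrankEq M B (by rw [hrank, Module.finrank_self])
  have h := (ext_length_equiv_iff (ModuleCat.of B M) zs hmem
    ((e.isRegular_congr zs).2 hreg)).1 (hM.type_one _ hlen)
  refine h.of_linearEquiv (Submodule.Quotient.equiv _ _ e ?_)
  rw [Submodule.map_smul'', Submodule.map_top, LinearEquiv.range, smul_eq_mul, Ideal.mul_top]

/-- The closed fibre of a finite free local Gorenstein algebra over a Gorenstein ring has simple
socle. -/
theorem exists_socle_generator {A B : Type u} [CommRing A] [CommRing B] [IsLocalRing A]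
    [IsLocalRing B] [IsNoetherianRing A] [Algebra A B] [Module.Finite A B] [Module.Free A B]
    {ys : List A} (hmem : ∀ r ∈ ys, r ∈ maximalIdeal A) (hreg : IsRegular A ys)
    (hlen : (ys.length : WithBot ℕ∞) = ringKrullDim A)
    (hsoc : HasSimpleSocle A (A ⧸ (Ideal.ofList ys • ⊤ : Ideal A)))
    (hB : IsGorensteinLocalRing B) :
    ∃ s : B, s ∉ (maximalIdeal A).map (algebraMap A B) ∧
      ∀ b ∉ (maximalIdeal A).map (algebraMap A B),
        ∃ c, s - c * b ∈ (maximalIdeal A).map (algebraMap A B) := by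
  have : IsNoetherianRing B := IsNoetherianRing.of_finite A B
  have hloc : IsLocalHom (algebraMap A B) := ((local_hom_TFAE (algebraMap A B)).out 0 2).2
    (map_maximalIdeal_le_of_finite A B)
  have hff : Module.FaithfullyFlat A B := Module.FaithfullyFlat.of_flat_of_isLocalHom
  have hreg' : IsRegular B (ys.map (algebraMap A B)) := hreg.of_faithfullyFlat
  have hmem' : ∀ r ∈ ys.map (algebraMap A B), r ∈ maximalIdeal B := by
    intro r hr
    obtain ⟨a, ha, rfl⟩ := List.mem_map.1 hr
    exact map_maximalIdeal_le_of_finite A B (Ideal.mem_map_of_mem _ (hmem a ha))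
  obtain ⟨z, hz0, hz, hzall⟩ := hB.hasSimpleSocle hmem' hreg'
    (map_algebraMap_length_eq_ringKrullDim hreg hlen hreg')
  obtain ⟨σ, hσ0, hσ, -⟩ := hsoc
  obtain ⟨z, rfl⟩ := Submodule.Quotient.mk_surjective _ z
  obtain ⟨σ, rfl⟩ := Submodule.Quotient.mk_surjective _ σ
  set J := (maximalIdeal A).map (algebraMap A B) with hJ
  set K := Ideal.ofList (ys.map (algebraMap A B)) with hK
  have hKmap : K = (Ideal.ofList ys).map (algebraMap A B) := (Ideal.map_ofList _ _).symm
  simp only [← Submodule.Quotient.mk_smul, Ne, Submodule.Quotient.mk_eq_zero, smul_eq_mul,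
    Ideal.mul_top] at hσ0 hσ hz0 hz
  -- Multiplication by the socle element σ of A/(ys) embeds the closed fibre B/J into B/K: `hσJ`
  -- says it is well defined, and `hσK`, checked on coordinates, that it is injective.
  have hσJ : ∀ x : B, x ∈ J → algebraMap A B σ * x ∈ K := by
    intro x hx
    have h : J ≤ Submodule.comap (LinearMap.mulLeft B (algebraMap A B σ)) K := by
      rw [hJ, Ideal.map_le_iff_le_comap]
      intro r hr
      change algebraMap A B σ * algebraMap A B r ∈ K
      rw [← map_mul, mul_comm, hKmap]
      exact Ideal.mem_map_of_mem _ (hσ r hr)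
    exact h hx
  have hσK : ∀ x : B, algebraMap A B σ * x ∈ K → x ∈ J := by
    intro x hx
    let b := Module.finBasis A B
    rw [hJ, mem_map_algebraMap_iff_repr b]
    rw [hKmap, mem_map_algebraMap_iff_repr b] at hx
    intro i
    by_contra hu
    rw [IsLocalRing.mem_maximalIdeal, mem_nonunits_iff, not_not] at hu
    have := hx i
    rw [← Algebra.smul_def, map_smul, Finsupp.smul_apply, smul_eq_mul] at this
    exact hσ0 ((Ideal.mul_unit_mem_iff_mem _ hu).1 this)
  -- A socle multiple cb of b in B/J is sent by σ to a nonzero socle element of B/K, hence to a unit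
  -- multiple of z.
  have key : ∀ b ∉ J, ∃ (c : B) (v : Bˣ), algebraMap A B σ * (c * b) - v * z ∈ K := by
    intro b hb
    obtain ⟨c, hcb, hc⟩ := exists_mul_notMem_of_notMem hb
    obtain ⟨v, hv⟩ := hzall (Submodule.Quotient.mk (algebraMap A B σ * (c * b))) fun r hr => by
      rw [← Submodule.Quotient.mk_smul, Submodule.Quotient.mk_eq_zero, smul_eq_mul,
        mul_left_comm]
      exact hσJ _ (hc r hr)
    rw [← Submodule.Quotient.mk_smul, Submodule.Quotient.eq, smul_eq_mul] at hv
    have hvu : IsUnit v := by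
      by_contra hvu
      refine hcb (hσK _ ?_)
      have := add_mem hv (hz v ((IsLocalRing.mem_maximalIdeal _).2 hvu))
      rwa [sub_add_cancel] at this
    obtain ⟨v, rfl⟩ := hvu
    exact ⟨c, v, hv⟩
  have h1 : (1 : B) ∉ J := fun h => (Ideal.ne_top_iff_one _).1 (maximalIdeal.isMaximal B).ne_top
    (map_maximalIdeal_le_of_finite A B h)
  obtain ⟨s, v, hs⟩ := key 1 h1
  rw [mul_one] at hs
  refine ⟨s, fun hsJ => hz0 ?_, fun b hb => ?_⟩
  · have := sub_mem (hσJ s hsJ) hs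
    rw [sub_sub_cancel] at this
    exact (Ideal.unit_mul_mem_iff_mem _ v.isUnit).1 this
  · obtain ⟨c, w, hc⟩ := key b hb
    -- Eliminating z between σs ≡ vz and σcb ≡ wz gives this coefficient.
    refine ⟨v * ↑w⁻¹ * c, hσK _ ?_⟩
    have := sub_mem hs (K.mul_mem_left (v * ↑w⁻¹) hc)
    convert this using 1
    linear_combination (-(v : B) * z) * w.inv_mul

/-- A finite free local Gorenstein algebra over a complete local complete intersection ring is
isomorphic to its dual. -/
theorem exists_bijective_trace_form {A B : Type u} [CommRing A] [CommRing B] [IsLocalRing A]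
    [IsLocalRing B] [IsNoetherianRing A] [IsAdicComplete (maximalIdeal A) A]
    [Algebra A B] [Module.Finite A B] [Module.Free A B]
    (hA : IsLocalCompleteIntersectionRing A) (hB : IsGorensteinLocalRing B) :
    ∃ τ : B →ₗ[A] A, Function.Bijective ((LinearMap.mul A B).compr₂ τ) := by
  obtain ⟨S, _, _, rs, q, hrs, hq, hker⟩ := hA.exists_surjective
  obtain ⟨ys, hmem, hreg, hlen, hsoc⟩ := exists_isRegular_and_hasSimpleSocle rs hrs q hq hker
  obtain ⟨s, hs, hall⟩ := exists_socle_generator hmem hreg hlen hsoc hB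
  let b := Module.finBasis A B
  rw [mem_map_algebraMap_iff_repr b] at hs
  push Not at hs
  obtain ⟨i, hi⟩ := hs
  -- A coordinate functional not vanishing on s in the closed fibre. Every nonzero element of the
  -- fibre has s as a multiple, so τ(xy) is nondegenerate there; this is `key`.
  let τ : B →ₗ[A] A := b.coord i
  have hτ : τ s ∉ maximalIdeal A := hi
  have key : ∀ x : B, (∀ j, τ (x * b j) ∈ maximalIdeal A) →
      x ∈ (maximalIdeal A).map (algebraMap A B) := by
    intro x hx
    by_contra hxJ
    obtain ⟨c, hc⟩ := hall x hxJ
    have h1 := apply_mem_of_mem_map_algebraMap τ hc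
    have h2 : τ (c * x) ∈ maximalIdeal A := by
      rw [mul_comm, ← b.sum_repr c, Finset.mul_sum, map_sum]
      refine Ideal.sum_mem _ fun j _ => ?_
      rw [mul_smul_comm, map_smul]
      exact Ideal.mul_mem_left _ _ (hx j)
    refine hτ ?_
    have := add_mem h1 h2
    rwa [map_sub, sub_add_cancel] at this
  refine ⟨τ, ?_⟩
  set Ψ := (LinearMap.mul A B).compr₂ τ with hΨ
  -- Were the determinant not a unit, a kernel vector over the residue field would lift to an x
  -- pairing into 𝔪_A with every basis vector, contradicting `key`.
  have hdet : IsUnit (LinearMap.toMatrix b b.dualBasis Ψ).det := by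
    by_contra hdet
    have h0 : ((LinearMap.toMatrix b b.dualBasis Ψ).map (residue A)).det = 0 := by
      rw [← RingHom.mapMatrix_apply, ← RingHom.map_det, residue_eq_zero_iff]
      exact hdet
    obtain ⟨v, hv0, hv⟩ := Matrix.exists_mulVec_eq_zero_iff.2 h0
    choose w hw using fun j => residue_surjective (R := A) (v j)
    apply hv0
    have hx := (mem_map_algebraMap_iff_repr b).1 (key (∑ j, w j • b j) fun k => ?_)
    · funext j
      rw [← hw, Pi.zero_apply, residue_eq_zero_iff]
      simpa [Finsupp.single_apply] using hx j
    · have hk := congrFun hv k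
      simp only [Matrix.mulVec, dotProduct, Matrix.map_apply, LinearMap.toMatrix_apply,
        Module.Basis.dualBasis_repr, ← hw, ← map_mul, ← map_sum, Pi.zero_apply,
        residue_eq_zero_iff] at hk
      rw [Finset.sum_mul, map_sum]
      convert hk using 2 with j
      rw [smul_mul_assoc, map_smul, smul_eq_mul, mul_comm]
      rfl
  exact (LinearEquiv.ofIsUnitDet hdet).bijective

end Frobenius

/-! ### The equivalences for I, R and R⁰ -/

section Setup

variable {O : Type v} {A R : Type u}
    [CommRing O] [IsDomain O] [IsDiscreteValuationRing O] [IsAdicComplete (maximalIdeal O) O]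
    [CommRing A] [IsLocalRing A] [IsNoetherianRing A] [IsAdicComplete (maximalIdeal A) A]
    [Algebra O A] [Module.Flat O A]
    [CommRing R] [IsLocalRing R] [Algebra A R]

namespace SingleEisensteinSetup

variable (S : SingleEisensteinSetup O A R)

theorem mul_eq_zero_of_mem {n i : R} (hn : n ∈ S.I.annihilator) (hi : i ∈ S.I) : n * i = 0 :=
  Submodule.mem_annihilator.1 hn i hi

theorem sub_algebraMap_eis_mem (r : R) : r - algebraMap A R (S.eis r) ∈ S.I := by
  rw [RingHom.mem_ker, map_sub, AlgHom.commutes, Algebra.algebraMap_self, RingHom.id_apply,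
    sub_self]

/-- Such an element is a r₀ with a · `eis r₀` = 0, so a = 0. Hence I maps injectively to R⁰. -/
theorem eq_zero_of_mem_of_mem_annihilator {y : R} (hy : y ∈ S.I) (hy' : y ∈ S.I.annihilator) :
    y = 0 := by
  have h : y ∈ Submodule.span A {S.r₀} := by
    rw [S.span_r₀]
    exact hy'
  obtain ⟨a, rfl⟩ := Submodule.mem_span_singleton.1 h
  have h0 : a * S.eis S.r₀ = 0 := by
    have := RingHom.mem_ker.1 hy
    rwa [map_smul, smul_eq_mul] at this
  rw [(mul_right_mem_nonZeroDivisors_eq_zero_iff S.eis_r₀).1 h0, zero_smul]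

theorem mem_of_mul_r₀_eq_zero {r : R} (h : r * S.r₀ = 0) : r ∈ S.I := by
  have := congrArg S.eis h
  rw [map_mul, map_zero] at this
  exact RingHom.mem_ker.2 ((mul_right_mem_nonZeroDivisors_eq_zero_iff S.eis_r₀).1 this)

theorem eis_surjective : Function.Surjective S.eis := fun a =>
  ⟨algebraMap A R a, by rw [AlgHom.commutes, Algebra.algebraMap_self, RingHom.id_apply]⟩

theorem isUnit_of_isUnit_eis {r : R} (h : IsUnit (S.eis r)) : IsUnit r := by
  have := IsLocalHom.of_surjective (S.eis : R →+* A) S.eis_surjective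
  exact isUnit_of_map_unit (S.eis : R →+* A) r h

theorem I_le_maximalIdeal : S.I ≤ maximalIdeal R :=
  IsLocalRing.le_maximalIdeal (RingHom.ker_ne_top _)

theorem I_eq_span_singleton_iff {t : R} (ht : t ∈ S.I) :
    S.I = Ideal.span {t} ↔ ∀ i ∈ S.I, ∃ c, i = c * t := by
  refine ⟨fun h i hi => ?_, fun h => le_antisymm (fun i hi => ?_)
    ((Ideal.span_singleton_le_iff_mem _).2 ht)⟩
  · rw [h, Ideal.mem_span_singleton'] at hi
    obtain ⟨c, hc⟩ := hi
    exact ⟨c, hc.symm⟩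
  · obtain ⟨c, rfl⟩ := h i hi
    exact Ideal.mul_mem_left _ _ (Ideal.mem_span_singleton_self t)

theorem I_isPrincipal_iff : S.I.IsPrincipal ↔ ∃ t ∈ S.I, S.I = Ideal.span {t} :=
  ⟨fun ⟨t, ht⟩ => ⟨t, ht ▸ Ideal.mem_span_singleton_self t, ht⟩, fun ⟨t, _, ht⟩ => ⟨t, ht⟩⟩

theorem I0_isPrincipal_iff : S.I0.IsPrincipal ↔ S.I.IsPrincipal := by
  refine ⟨fun ⟨g, hg⟩ => ?_, fun ⟨t, ht⟩ => ⟨Ideal.Quotient.mk _ t, ?_⟩⟩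
  · have hgI : g ∈ S.I0 := hg ▸ Submodule.mem_span_singleton_self g
    obtain ⟨t, ht, rfl⟩ :=
      (Ideal.mem_map_iff_of_surjective _ Ideal.Quotient.mk_surjective).1 hgI
    refine S.I_isPrincipal_iff.2 ⟨t, ht, (S.I_eq_span_singleton_iff ht).2 fun i hi => ?_⟩
    have hi0 : Ideal.Quotient.mk S.I.annihilator i ∈ S.I0 := Ideal.mem_map_of_mem _ hi
    rw [hg] at hi0
    obtain ⟨c, hc⟩ := Submodule.mem_span_singleton.1 hi0
    obtain ⟨c, rfl⟩ := Ideal.Quotient.mk_surjective c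
    refine ⟨c, sub_eq_zero.1 (S.eq_zero_of_mem_of_mem_annihilator
      (sub_mem hi (Ideal.mul_mem_left _ c ht)) ?_)⟩
    rw [← Ideal.Quotient.eq, map_mul]
    exact hc.symm
  · have : ∀ J : Ideal R, J.map (Ideal.Quotient.mk S.I.annihilator) = S.I0 →
        J = Ideal.span {t} → S.I0 = Ideal.span {Ideal.Quotient.mk S.I.annihilator t} := by
      rintro J hJ rfl
      rw [← hJ, Ideal.map_span, Set.image_singleton]
    exact this S.I rfl ht

theorem free_finrank_eq_one_iff (hR0 : Nontrivial S.R0) :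
    Module.Free S.R0 S.I ∧ Module.finrank S.R0 S.I = 1 ↔ S.I.IsPrincipal := by
  rw [I_isPrincipal_iff]
  constructor
  · rintro ⟨_, h1⟩
    -- Rank 1 is not the default value 0 of `finrank`, so the module is finite.
    have : Module.Finite S.R0 S.I := Module.finite_of_finrank_pos (by omega)
    let e : S.R0 ≃ₗ[S.R0] S.I :=
      LinearEquiv.ofFinrankEq S.R0 S.I (by rw [h1, Module.finrank_self])
    refine ⟨e 1, (e 1).2, (S.I_eq_span_singleton_iff (e 1).2).2 fun i hi => ?_⟩
    obtain ⟨c, hc⟩ := e.surjective ⟨i, hi⟩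
    obtain ⟨c, rfl⟩ := Ideal.Quotient.mk_surjective c
    refine ⟨c, ?_⟩
    have h2 : (Ideal.Quotient.mk S.I.annihilator c) • e 1 = ⟨i, hi⟩ := by
      rw [← map_smul, smul_eq_mul, mul_one, hc]
    exact (congrArg Subtype.val h2).symm
  · rintro ⟨t, ht, htI⟩
    let g : S.R0 →ₗ[S.R0] S.I := LinearMap.toSpanSingleton S.R0 S.I ⟨t, ht⟩
    have hg : Function.Bijective g := by
      constructor
      · rw [injective_iff_map_eq_zero]
        intro r hr
        obtain ⟨r, rfl⟩ := Ideal.Quotient.mk_surjective r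
        rw [Ideal.Quotient.eq_zero_iff_mem, Submodule.mem_annihilator]
        intro i hi
        obtain ⟨c, rfl⟩ := (S.I_eq_span_singleton_iff ht).1 htI i hi
        have : r * t = 0 := congrArg Subtype.val hr
        rw [smul_eq_mul, mul_left_comm, this, mul_zero]
      · rintro ⟨i, hi⟩
        obtain ⟨c, rfl⟩ := (S.I_eq_span_singleton_iff ht).1 htI i hi
        exact ⟨Ideal.Quotient.mk _ c, rfl⟩
    let e := LinearEquiv.ofBijective g hg
    exact ⟨Module.Free.of_equiv e, by rw [← e.finrank_eq, Module.finrank_self]⟩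

theorem isLocalRing_R0 (hR0 : Nontrivial S.R0) : IsLocalRing S.R0 :=
  IsLocalRing.of_surjective' (Ideal.Quotient.mk _) Ideal.Quotient.mk_surjective

theorem finite_R0 : Module.Finite A S.R0 :=
  have := S.finite
  Module.Finite.of_surjective (Ideal.Quotient.mkₐ A S.I.annihilator).toLinearMap
    Ideal.Quotient.mk_surjective

/-- Every b is `eis b` plus an element of I = (t), so R is generated by t over A; the same
decomposition holds modulo Ann(I). -/
theorem isLocalCompleteIntersectionRing_of_isPrincipal (hR0 : Nontrivial S.R0)
    (h : S.I.IsPrincipal) :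
    IsLocalCompleteIntersectionRing R ∧ IsLocalCompleteIntersectionRing S.R0 := by
  obtain ⟨t, ht, htI⟩ := S.I_isPrincipal_iff.1 h
  have := S.finite
  have := S.free
  have := S.finite_R0
  have := S.free_quotient
  have := S.isLocalRing_R0 hR0
  have htm := S.I_le_maximalIdeal ht
  have hdec : ∀ b : R, ∃ (a : A) (c : R), b = algebraMap A R a + t * c := fun b => by
    obtain ⟨c, hc⟩ := (S.I_eq_span_singleton_iff ht).1 htI _ (S.sub_algebraMap_eis_mem b)
    exact ⟨S.eis b, c, by linear_combination hc⟩
  refine ⟨isLocalCompleteIntersectionRing_of_exists_add_mul S.completeIntersection htm hdec,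
    isLocalCompleteIntersectionRing_of_exists_add_mul (t := Ideal.Quotient.mk _ t)
      S.completeIntersection ?_ fun b => ?_⟩
  · have := IsLocalHom.of_surjective (Ideal.Quotient.mk S.I.annihilator)
      Ideal.Quotient.mk_surjective
    exact map_nonunit _ _ htm
  · obtain ⟨b, rfl⟩ := Ideal.Quotient.mk_surjective b
    obtain ⟨a, c, rfl⟩ := hdec b
    exact ⟨a, Ideal.Quotient.mk _ c, by rw [map_add, map_mul]; rfl⟩

theorem isGorensteinLocalRing_of_isLocalCompleteIntersectionRing (hR0 : Nontrivial S.R0)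
    (h : IsLocalCompleteIntersectionRing R ∧ IsLocalCompleteIntersectionRing S.R0) :
    IsGorensteinLocalRing R ∧ IsGorensteinLocalRing S.R0 := by
  have := S.finite
  have := S.finite_R0
  have := S.isLocalRing_R0 hR0
  have := isAdicComplete_maximalIdeal_of_finite A R
  have := isAdicComplete_maximalIdeal_of_finite A S.R0
  exact ⟨_root_.isGorensteinLocalRing_of_isLocalCompleteIntersectionRing h.1,
    _root_.isGorensteinLocalRing_of_isLocalCompleteIntersectionRing h.2⟩

/-- An `A`-linear functional on `R` that vanishes on `Ann I` factors through `R⁰`. -/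
theorem exists_eq_comp_mk (ℓ : R →ₗ[A] A) (hℓ : ∀ n ∈ S.I.annihilator, ℓ n = 0) :
    ∃ g : S.R0 →ₗ[A] A, ∀ s, ℓ s = g (Ideal.Quotient.mk S.I.annihilator s) :=
  ⟨(S.I.annihilator.restrictScalars A).liftQ ℓ hℓ, fun _ => rfl⟩

/-- The generator t represents the pullback of τ₀ under τ. It lies in I because this functional
kills r₀R, so t r₀ = 0. Functionals killing Ann(I), such as τ(i ·) for i in I, are pullbacks of
multiples of τ₀. -/
theorem isPrincipal_of_isGorensteinLocalRing (hR0 : Nontrivial S.R0)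
    (h : IsGorensteinLocalRing R ∧ IsGorensteinLocalRing S.R0) : S.I.IsPrincipal := by
  have := S.finite
  have := S.free
  have := S.finite_R0
  have := S.free_quotient
  have := S.isLocalRing_R0 hR0
  obtain ⟨τ, hτ⟩ := exists_bijective_trace_form S.completeIntersection h.1
  obtain ⟨τ₀, hτ₀⟩ := exists_bijective_trace_form S.completeIntersection h.2
  let π : R →ₐ[A] S.R0 := Ideal.Quotient.mkₐ A S.I.annihilator
  obtain ⟨t, ht⟩ := hτ.2 (τ₀ ∘ₗ π.toLinearMap)
  have ht' : ∀ s, τ (t * s) = τ₀ (π s) := fun s => LinearMap.congr_fun ht s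
  have hinj : ∀ y z : R, (∀ s, τ (y * s) = τ (z * s)) → y = z := fun y z hyz =>
    hτ.1 (LinearMap.ext hyz)
  have hπ : ∀ n ∈ S.I.annihilator, π n = 0 := fun n hn => Ideal.Quotient.eq_zero_iff_mem.2 hn
  have htI : t ∈ S.I := by
    refine S.mem_of_mul_r₀_eq_zero (hinj _ _ fun s => ?_)
    rw [zero_mul, map_zero, mul_assoc, ht', hπ _ (Ideal.mul_mem_right _ _ S.r₀_mem), map_zero]
  refine S.I_isPrincipal_iff.2 ⟨t, htI, (S.I_eq_span_singleton_iff htI).2 fun i hi => ?_⟩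
  obtain ⟨g, hg⟩ := S.exists_eq_comp_mk ((LinearMap.mul A R).compr₂ τ i) fun n hn => by
    rw [LinearMap.compr₂_apply, LinearMap.mul_apply', mul_comm, S.mul_eq_zero_of_mem hn hi,
      map_zero]
  obtain ⟨c, rfl⟩ := hτ₀.2 g
  obtain ⟨c, rfl⟩ := Ideal.Quotient.mk_surjective c
  refine ⟨c, hinj _ _ fun s => ?_⟩
  rw [mul_comm c, mul_assoc, ht', map_mul π]
  exact hg s

end SingleEisensteinSetup

/-! ### Generators of X⁰ -/

namespace LSymbolSetup

variable {S : SingleEisensteinSetup O A R} {p : ℕ} {X : Type w}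
    [AddCommGroup X] [Module O X] [Module A X] [Module R X]
    [IsScalarTower O A X] [IsScalarTower A R X]
    (T : LSymbolSetup S p X)

/-- The functional attached to i • y kills Ann(I), because i does, and so factors through R⁰. -/
theorem φ_smul_eq_zero {i : R} (hi : i ∈ S.I) (y : X) : T.φ (i • y) = 0 := by
  obtain ⟨f, hf, hker⟩ := T.exists_equiv
  refine (hker _).2 (S.exists_eq_comp_mk _ fun n hn => ?_)
  rw [hf, mul_comm, S.mul_eq_zero_of_mem hn hi, map_zero]

theorem φ_smul (r : R) (y : X) : T.φ (r • y) = S.eis r * T.φ y := by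
  have h := T.φ_smul_eq_zero (S.sub_algebraMap_eis_mem r) y
  rwa [sub_smul, algebraMap_smul, map_sub, T.φ.map_smul, smul_eq_mul, sub_eq_zero] at h

theorem smulGenerates_iff {t : R} (ht : t ∈ S.I) :
    T.SmulGenerates t ↔ ∀ y, T.φ y = 0 → ∃ c : R, y = (c * t) • T.x := by
  have hmem : t • T.x ∈ T.X0 := T.φ_smul_eq_zero ht _
  have key : ∀ (c : R) (y : T.X0), Ideal.Quotient.mk S.I.annihilator c • y = c • y :=
    fun c y => rfl
  constructor
  · rintro ⟨h, hspan⟩ y hy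
    have hy' : (⟨y, hy⟩ : T.X0) ∈ Submodule.span S.R0 {(⟨t • T.x, h⟩ : T.X0)} :=
      hspan ▸ trivial
    obtain ⟨c, hc⟩ := Submodule.mem_span_singleton.1 hy'
    obtain ⟨c, rfl⟩ := Ideal.Quotient.mk_surjective c
    rw [key] at hc
    exact ⟨c, by rw [mul_smul]; exact (congrArg Subtype.val hc).symm⟩
  · refine fun h => ⟨hmem, top_le_iff.1 fun y _ => Submodule.mem_span_singleton.2 ?_⟩
    obtain ⟨c, hc⟩ := h y y.2
    refine ⟨Ideal.Quotient.mk _ c, ?_⟩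
    rw [key]
    apply Subtype.ext
    rw [hc, mul_smul]
    rfl

/-- Evaluate functionals of r • y at 1: functionals separate the points of the free module R. -/
theorem eq_zero_of_forall_smul_eq_zero (T : LSymbolSetup S p X) {r : R} (h : ∀ y : X, r • y = 0) : r = 0 := by
  have := S.free
  obtain ⟨f, hf, -⟩ := T.exists_equiv
  rw [← Module.forall_dual_apply_eq_zero_iff A]
  intro g
  have h1 := hf r (f.symm g) 1
  rw [h, map_zero, LinearMap.zero_apply, f.apply_symm_apply, mul_one] at h1
  exact h1.symm

/-- Subtracting φ(y)x from y lands in X⁰, so x generates X over R. Then ix = ctx means that i - ct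
kills X, which is faithful. -/
theorem I_eq_span_of_smulGenerates {t : R} (ht : t ∈ S.I) (h : T.SmulGenerates t) :
    S.I = Ideal.span {t} := by
  rw [T.smulGenerates_iff ht] at h
  have hgen : ∀ y : X, ∃ c : R, y = c • T.x := fun y => by
    obtain ⟨c, hc⟩ := h (y - T.φ y • T.x) (by rw [map_sub, map_smul, T.φ_x, smul_eq_mul,
      mul_one, sub_self])
    refine ⟨c * t + algebraMap A R (T.φ y), ?_⟩
    rw [add_smul, algebraMap_smul, ← hc, sub_add_cancel]
  refine (S.I_eq_span_singleton_iff ht).2 fun i hi => ?_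
  obtain ⟨c, hc⟩ := h (i • T.x) (T.φ_smul_eq_zero hi _)
  refine ⟨c, sub_eq_zero.1 (T.eq_zero_of_forall_smul_eq_zero fun y => ?_)⟩
  obtain ⟨d, rfl⟩ := hgen y
  rw [smul_comm, sub_smul, hc, sub_self, smul_zero]

/-- Self-duality makes X cyclic on the element z corresponding to τ. Writing x = uz, 1 = φ(x) = `eis
u` · φ(z) shows that u is a unit, so x generates X too, and vx lies in X⁰ exactly when v is in I. -/
theorem smulGenerates_of_isGorensteinLocalRing (hR : IsGorensteinLocalRing R) {t : R}
    (ht : t ∈ S.I) (h : S.I = Ideal.span {t}) : T.SmulGenerates t := by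
  have := S.finite
  have := S.free
  obtain ⟨τ, hτ⟩ := exists_bijective_trace_form S.completeIntersection hR
  obtain ⟨f, hf, -⟩ := T.exists_equiv
  have hz : ∀ y : X, ∃ u : R, y = u • f.symm τ := fun y => by
    obtain ⟨u, hu⟩ := hτ.2 (f y)
    refine ⟨u, f.injective (LinearMap.ext fun s => ?_)⟩
    rw [hf, f.apply_symm_apply, ← hu]
    rfl
  obtain ⟨u, hu⟩ := hz T.x
  have huu : IsUnit u := by
    refine S.isUnit_of_isUnit_eis (IsUnit.of_mul_eq_one (T.φ (f.symm τ)) ?_)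
    rw [← T.φ_smul, ← hu, T.φ_x]
  obtain ⟨u, rfl⟩ := huu
  refine (T.smulGenerates_iff ht).2 fun y hy => ?_
  obtain ⟨v, rfl⟩ := hz y
  have hv : v • f.symm τ = (v * ↑u⁻¹) • T.x := by
    rw [hu, smul_smul, mul_assoc, Units.inv_mul, mul_one]
  rw [hv, T.φ_smul, T.φ_x, mul_one] at hy
  obtain ⟨c, hc⟩ := (S.I_eq_span_singleton_iff ht).1 h _ (RingHom.mem_ker.2 hy)
  exact ⟨c, by rw [hv, hc]⟩

end LSymbolSetup

end Setup

theorem mainTheorem3 {O : Type v} {A R : Type u}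
    [CommRing O] [IsDomain O] [IsDiscreteValuationRing O] [IsAdicComplete (maximalIdeal O) O]
    [CommRing A] [IsLocalRing A] [IsNoetherianRing A] [IsAdicComplete (maximalIdeal A) A]
    [Algebra O A] [Module.Flat O A]
    [CommRing R] [IsLocalRing R] [Algebra A R]
    (S : SingleEisensteinSetup O A R) (hR0 : Nontrivial S.R0)
    (p : ℕ) (hp : p.Prime) {X : Type w}
    [AddCommGroup X] [Module O X] [Module A X] [Module R X]
    [IsScalarTower O A X] [IsScalarTower A R X]
    (T : LSymbolSetup S p X) :
    List.TFAE [
      S.I0.IsPrincipal,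
      S.I.IsPrincipal,
      Module.Free S.R0 S.I ∧ Module.finrank S.R0 S.I = 1,
      IsLocalCompleteIntersectionRing R ∧ IsLocalCompleteIntersectionRing S.R0,
      IsGorensteinLocalRing R ∧ IsGorensteinLocalRing S.R0,
      ∃ t ∈ S.I, T.SmulGenerates t] ∧
    ∀ t ∈ S.I, S.I = Ideal.span {t} ↔ T.SmulGenerates t := by
  have h24 := S.isLocalCompleteIntersectionRing_of_isPrincipal hR0
  have h45 := S.isGorensteinLocalRing_of_isLocalCompleteIntersectionRing hR0
  -- The last assertion is proved unconditionally: if t generates I, R is Gorenstein by 2 → 4 → 5.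
  -- It then yields 2 ↔ 6.
  have hiff : ∀ t ∈ S.I, S.I = Ideal.span {t} ↔ T.SmulGenerates t := fun t ht =>
    ⟨fun h => T.smulGenerates_of_isGorensteinLocalRing (h45 (h24 ⟨t, h⟩)).1 ht h,
      T.I_eq_span_of_smulGenerates ht⟩
  refine ⟨?_, hiff⟩
  tfae_have 1 ↔ 2 := S.I0_isPrincipal_iff
  tfae_have 3 ↔ 2 := S.free_finrank_eq_one_iff hR0
  tfae_have 2 → 4 := h24
  tfae_have 4 → 5 := h45
  tfae_have 5 → 2 := S.isPrincipal_of_isGorensteinLocalRing hR0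
  tfae_have 2 ↔ 6 := S.I_isPrincipal_iff.trans
    (exists_congr fun t => and_congr_right fun ht => hiff t ht)
  tfae_finish
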